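/- **Definition.** Let $a\ge 0$. A real function $F$ on $[a,\infty)$ is *moderately decreasing* on $[a,\infty)$ if there are constants $B_1,B_2>0$ and a nonincreasing function $\varphi$ on $[a,\infty)$ with $\varphi(x)=1$ for $x\in[a,\max(1,a)]$ and $\lim_{u\to\infty}\varphi(u)=0$ such that $$F(u+v)-F(u)\ \ge\ -B_1v-B_2\max(1,u)\varphi(u)\qquad(u\ge a,\ v\ge 0).$$ **Theorem.** Let $A:\mathbb R\to\mathbb R$ be a function of locally bounded variation vanishing on $(-\infty,1)$, such that the Mellin–Stieltjes transform $\mathcal A(s):=\int_{1}^{\infty}x^{-s}\,dA(x)$ (an improper integral over $[1,\infty)$, a possible jump of $A$ at $1$ being included) converges for $\Re s>1$. Let $n\ge 0$ and $m_0,\dots,m_n\ge 1$ be integers, and for $0\le k\le n$, $1\le l\le m_k$ let $c_{k,l}\in\mathbb C$, let $\omega_{k,l}>-1$ be real, and let $b_k$ be real with $b_0=0$ and $b_k>0$ for $k\ge1$. For $\Re s>0$ put (with principal branches of the powers) $$G(s)=\frac{\mathcal A(s+1)}{s+1}-\sum_{k=0}^{n}\sum_{l=1}^{m_k}\left(\frac{c_{k,l}}{(s+ib_k)^{\omega_{k,l}+1}}+\frac{\overline{c_{k,l}}}{(s-ib_k)^{\omega_{k,l}+1}}\right),$$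 and for $\sigma,T>0$ put $$\eta(\sigma,T)=\int_{-T}^{T}\bigl|G(2\sigma+i\tau)-G(\sigma+i\tau)\bigr|\,d\tau .$$ Assume that $A$ is moderately decreasing on $[0,\infty)$, with constants $B_1,B_2$ and function $\varphi$. Let $\Omega=\max_{k,l}\omega_{k,l}$, $\omega=\min_{k,l}\omega_{k,l}$ and $\Omega_+=\max(\Omega,0)$. Then for every $T>0$ and every $x\ge\max(e^{16/15},e^{32/T})$, $$\left|A(x)-x\sum_{k=0}^{n}\sum_{l=1}^{m_k}\frac{(\log x)^{\omega_{k,l}}}{\Gamma(\omega_{k,l}+1)}\,2\Re\!\left(c_{k,l}e^{-ib_k\log x}\right)\right|\ \le\ C\,x\,\rho_T(x),$$ where $$\rho_T(x)=\sqrt{\varphi(\sqrt x)}+\max_{\kappa\in\{1/2,\,1\}}\left\{\Bigl(\frac{e^{10/T}}{T}+1\Bigr)\eta\Bigl(\frac1{\log x},T\Bigr)+\frac{e^{10/T}}{T}(\log x)^{\Omega_+}+\frac{1}{\log x}\Bigl(\frac1{T^{\Omega+1}}+\frac1{T^{\omega+1}}\Bigr)\right\}^{\kappa},$$ and where the constant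 $C$ depends only on $B_1$, $B_2$, $n$, the $m_k$, the $c_{k,l}$, the $b_k$, $\Omega$ and $\sup_{1\le x\le e}\max(-A(x),0)$. -/

import Mathlib

noncomputable section

open MeasureTheory Filter Topology

/-- `F` is moderately decreasing on `[a, ∞)` with the constants `B₁, B₂` and the comparison function
`φ`. The class of moderately decreasing functions consists of the `F` for which such `B₁`, `B₂`, `φ`
exist. -/
structure IsModeratelyDecreasingWith (F : ℝ → ℝ) (a B₁ B₂ : ℝ) (φ : ℝ → ℝ) : Prop where
  B₁_pos : 0 < B₁
  B₂_pos : 0 < B₂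
  antitoneOn : AntitoneOn φ (Set.Ici a)
  eq_one : ∀ x ∈ Set.Icc a (max 1 a), φ x = 1
  tendsto_zero : Tendsto φ atTop (𝓝 0)
  lower_bound : ∀ u v : ℝ, a ≤ u → 0 ≤ v →
    -B₁ * v - B₂ * max 1 u * φ u ≤ F (u + v) - F u

/-- The function that agrees with `A` on `[a, b]` and is constant on each side of it. -/
def truncateTo (A : ℝ → ℝ) (a b x : ℝ) : ℝ := A (max a (min x b))

theorem LocallyBoundedVariationOn.truncateTo {A : ℝ → ℝ}
    (hA : LocallyBoundedVariationOn A Set.univ) (a b : ℝ) :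
    BoundedVariationOn (truncateTo A a b) Set.univ := by
  have h := hA a (max a b) (Set.mem_univ _) (Set.mem_univ _)
  have hmono : MonotoneOn (fun x : ℝ => max a (min x b)) Set.univ := by
    intro x _ y _ hxy
    exact max_le_max le_rfl (min_le_min hxy le_rfl)
  have hmaps : Set.MapsTo (fun x : ℝ => max a (min x b)) Set.univ
      (Set.univ ∩ Set.Icc a (max a b)) := by
    intro x _
    exact ⟨Set.mem_univ _, le_max_left _ _, max_le_max le_rfl (min_le_right _ _)⟩
  exact ne_top_of_le_ne_top h (eVariationOn.comp_le_of_monotoneOn A _ hmono hmaps)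

/-- The Lebesgue-Stieltjes integral `∫_{1⁻}^X x^{-s} dA(x)` of a function `A` of locally bounded
variation, for `X ≥ 1`. A possible jump of `A` at `1` is included. -/
def mellinStieltjesUpTo {A : ℝ → ℝ} (hA : LocallyBoundedVariationOn A Set.univ) (s : ℂ) (X : ℝ) :
    ℂ :=
  ∫ᵛ x in Set.Ici (1 : ℝ), (x : ℂ) ^ (-s) ∂<•(hA.truncateTo 0 X).vectorMeasure

/-- The improper integral `∫_1^∞ x^{-s} dA(x)` converges. -/
def MellinStieltjesConvergent {A : ℝ → ℝ} (hA : LocallyBoundedVariationOn A Set.univ) (s : ℂ) :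
    Prop :=
  ∃ L : ℂ, Tendsto (mellinStieltjesUpTo hA s) atTop (𝓝 L)

/-- The Mellin-Stieltjes transform `𝒜(s) = ∫_1^∞ x^{-s} dA(x)`, where it converges. -/
def mellinStieltjes {A : ℝ → ℝ} (hA : LocallyBoundedVariationOn A Set.univ) (s : ℂ) : ℂ :=
  limUnder atTop (mellinStieltjesUpTo hA s)

/-- `G(s) = 𝒜(s+1)/(s+1) - ∑_{k,l} (c_{k,l} (s+ib_k)^{-ω_{k,l}-1} + c̄_{k,l} (s-ib_k)^{-ω_{k,l}-1})`,
with principal branches of the powers (used for `Re s > 0`). -/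
def boundaryG {A : ℝ → ℝ} (hA : LocallyBoundedVariationOn A Set.univ) {n : ℕ}
    {m : Fin (n + 1) → ℕ} (c : (k : Fin (n + 1)) → Fin (m k) → ℂ) (b : Fin (n + 1) → ℝ)
    (ω : (k : Fin (n + 1)) → Fin (m k) → ℝ) (s : ℂ) : ℂ :=
  mellinStieltjes hA (s + 1) / (s + 1) -
    ∑ k, ∑ l, (c k l / (s + Complex.I * (b k : ℂ)) ^ ((ω k l : ℂ) + 1) +
      (starRingEnd ℂ) (c k l) / (s - Complex.I * (b k : ℂ)) ^ ((ω k l : ℂ) + 1))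

/-- `η(σ, T) = ∫_{-T}^{T} |G(2σ+iτ) - G(σ+iτ)| dτ`. -/
def etaOf (G : ℂ → ℂ) (σ T : ℝ) : ℝ :=
  ∫ τ in (-T)..T, ‖G (2 * (σ : ℂ) + Complex.I * (τ : ℂ)) - G ((σ : ℂ) + Complex.I * (τ : ℂ))‖

/-- The quantity inside the braces of the error function `ρ_T(x)`, as a function of
`η = η(1/log x, T)`, of `T` and `x`, and of the smallest exponent `ωmin` and the largest `Ω`. -/
def errorBase (η T x ωmin Ω : ℝ) : ℝ :=
  (Real.exp (10 / T) / T + 1) * η + Real.exp (10 / T) / T * Real.log x ^ max Ω 0 +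
    1 / Real.log x * (1 / T ^ (Ω + 1) + 1 / T ^ (ωmin + 1))

/-- The error function `ρ_T(x) = √φ(√x) + max_{κ = 1/2, 1} {…}^κ`. -/
def errorRho (φ : ℝ → ℝ) (η T x ωmin Ω : ℝ) : ℝ :=
  √(φ √x) + max (errorBase η T x ωmin Ω ^ (1 / 2 : ℝ)) (errorBase η T x ωmin Ω ^ (1 : ℝ))

end

section WienerIkehara

open MeasureTheory Filter Topology Set

/-! In the variable t = log x put a(t) = A(e^t)e^{-t} and let r(t) be the oscillating main term.
Integration by parts turns 𝒜(s+1)/(s+1) into the Laplace transform of a, and each pair of singular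
terms is the Laplace transform of one summand of r. So G is the Laplace transform of a - r on Re s >
0 (`boundaryG_eq_laplace`). Fix y = log x. The function H(t) = (a(t) - r(t))(e^{-t/y} - e^{-2t/y}),
t > 0, is integrable with Fourier transform G(1/y+iτ) - G(2/y+iτ), so each of its Fejér means of
bandwidth T, wherever centred, is at most η(1/y, T) in absolute value
(`integrable_weightedDiff_and_fejer_mean_le`). The weight is at least 1/8 on [y/2, 3y/2], so it
suffices to bound H(y).

The rest is Tauberian: moderate decrease means that a cannot fall quickly. With the positivity of
the Fejér kernel this bounds |H| everywhere by a multiple of e^{1/T}(η + (log x)^{Ω₊})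
(`abs_weightedDiff_le`), which is enough for T < 1. For T ≥ 1 the global bound makes H slowly
decreasing near y, up to an error of order (η + (log x)^{Ω₊})/T + φ(√x) over steps of length 64/T. A
large value of H then forces a large mean next to it, unless H is very negative elsewhere. Playing
upper and lower bounds against each other on shrinking windows contracts the estimate
(`abs_le_of_fejer_mean`) to order η + (log x)^{Ω₊}/T + φ(√x) (`abs_sub_le_of_fejer_mean`). Both
cases are dominated by ρ_T, already through its exponent κ = 1. -/

/-! ### From the Mellin–Stieltjes transform to a Laplace transform -/

theorem leftLim_truncateTo_one {A : ℝ → ℝ} (hA1 : ∀ x < 1, A x = 0) (X : ℝ) :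
    (truncateTo A 0 X).leftLim 1 = 0 := by
  apply leftLim_eq_of_tendsto
  apply Tendsto.congr' (f₁ := fun _ => 0) _ tendsto_const_nhds
  filter_upwards [self_mem_nhdsWithin] with x hx
  have hx : x < 1 := hx
  rw [truncateTo, hA1]
  exact max_lt one_pos ((min_le_left _ _).trans_lt hx)

theorem LocallyBoundedVariationOn.measurable_univ {A : ℝ → ℝ}
    (hA : LocallyBoundedVariationOn A univ) : Measurable A := by
  obtain ⟨p, q, hp, hq, rfl⟩ := hA.exists_monotoneOn_sub_monotoneOn
  exact (monotoneOn_univ.1 hp).measurable.sub (monotoneOn_univ.1 hq).measurable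

theorem LocallyBoundedVariationOn.ae_leftLim_eq {A : ℝ → ℝ}
    (hA : LocallyBoundedVariationOn A univ) : ∀ᵐ x, A.leftLim x = A x := by
  filter_upwards [hA.ae_differentiableAt] with x hx
  exact hx.continuousAt.continuousWithinAt.leftLim_eq

theorem LocallyBoundedVariationOn.exists_bound_Icc {A : ℝ → ℝ}
    (hA : LocallyBoundedVariationOn A univ) (a b : ℝ) : ∃ K, ∀ x ∈ Icc a b, |A x| ≤ K := by
  obtain ⟨p, q, hp, hq, rfl⟩ := hA.exists_monotoneOn_sub_monotoneOn
  rw [monotoneOn_univ] at hp hq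
  refine ⟨max (p b - q a) (q b - p a), fun x hx => ?_⟩
  have h1 := hp hx.1
  have h2 := hp hx.2
  have h3 := hq hx.1
  have h4 := hq hx.2
  rw [Pi.sub_apply, abs_le]
  constructor
  · have := le_max_right (p b - q a) (q b - p a)
    linarith
  · have := le_max_left (p b - q a) (q b - p a)
    linarith

/-- Writing `x^{-s}` as a tail integral, by Fubini's theorem. -/
theorem setIntegral_Ici_cpow_neg (P : Measure ℝ) [IsFiniteMeasure P] {s : ℂ} (hs : 0 < s.re) :
    ∫ x in Ici (1 : ℝ), (x : ℂ) ^ (-s) ∂P =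
      s * ∫ u in Ioi (1 : ℝ), (P.real (Ico 1 u) : ℂ) * (u : ℂ) ^ (-s - 1) := by
  have hs0 : s ≠ 0 := by rintro rfl; simp at hs
  have hre : (-s - 1).re < -1 := by simp; linarith
  have h1 : ∀ x ∈ Ici (1 : ℝ), (x : ℂ) ^ (-s) =
      ∫ u in Ioi (1 : ℝ), (Ioi x).indicator (fun u : ℝ => s * (u : ℂ) ^ (-s - 1)) u := by
    intro x hx
    have hx : 1 ≤ x := hx
    rw [setIntegral_indicator measurableSet_Ioi,
      inter_eq_right.2 (Ioi_subset_Ioi hx), integral_const_mul,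
      integral_Ioi_cpow_of_lt hre (by linarith)]
    simp only [sub_add_cancel]
    field_simp
  rw [setIntegral_congr_fun measurableSet_Ici h1, integral_integral_swap]
  · rw [← integral_const_mul]
    apply setIntegral_congr_fun measurableSet_Ioi
    intro u hu
    have : ∀ x : ℝ, (Ioi x).indicator (fun u : ℝ => s * (u : ℂ) ^ (-s - 1)) u =
        (Iio u).indicator (fun _ => s * (u : ℂ) ^ (-s - 1)) x := by
      intro x
      by_cases h : x < u <;> simp [h]
    simp only [this]
    rw [setIntegral_indicator measurableSet_Iio, Ici_inter_Iio, setIntegral_const]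
    simp
    ring
  · have hint : Integrable (fun u : ℝ => s * (u : ℂ) ^ (-s - 1)) (volume.restrict (Ioi 1)) :=
      (integrableOn_Ioi_cpow_of_lt hre one_pos).const_mul s
    have h2 := hint.comp_snd (P.restrict (Ici 1))
    refine (h2.indicator (s := {p : ℝ × ℝ | p.1 < p.2})
      (measurableSet_lt measurable_fst measurable_snd)).congr ?_
    filter_upwards with p
    by_cases h : p.1 < p.2 <;> simp [Function.uncurry, h]

/-- Fubini is applied to the two parts of the Jordan decomposition. The signed mass of [1, u) that
results is a left limit of the truncation, which agrees with its value for almost every u because a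
function of bounded variation is differentiable almost everywhere. -/
theorem mellinStieltjesUpTo_eq_integral {A : ℝ → ℝ} (hA : LocallyBoundedVariationOn A univ)
    (hA1 : ∀ x < 1, A x = 0) {s : ℂ} (hs : 0 < s.re) (X : ℝ) :
    mellinStieltjesUpTo hA s X =
      s * ∫ u in Ioi (1 : ℝ), (truncateTo A 0 X u : ℂ) * (u : ℂ) ^ (-s - 1) := by
  set hB := hA.truncateTo 0 X with hBdef
  set μ : SignedMeasure ℝ := hB.vectorMeasure with hμ
  set j := μ.toJordanDecomposition with hj
  have hre : (-s - 1).re < -1 := by simp; linarith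
  have hdec : μ = j.posPart.toSignedMeasure - j.negPart.toSignedMeasure :=
    (SignedMeasure.toSignedMeasure_toJordanDecomposition μ).symm
  have hcpow : ∀ P : Measure ℝ, [IsFiniteMeasure P] →
      IntegrableOn (fun x : ℝ => (x : ℂ) ^ (-s)) (Ici 1) P := by
    intro P _
    refine Measure.integrableOn_of_bounded (M := 1) (measure_ne_top _ _) ?_ ?_
    · exact (by fun_prop : Measurable fun x : ℝ => (x : ℂ) ^ (-s)).aestronglyMeasurable
    · rw [ae_restrict_iff' measurableSet_Ici]
      filter_upwards with x hx
      have hx : 1 ≤ x := hx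
      rw [Complex.norm_cpow_eq_rpow_re_of_pos (by linarith)]
      exact Real.rpow_le_one_of_one_le_of_nonpos hx (by simp; linarith)
  have hIntU : ∀ P : Measure ℝ, [IsFiniteMeasure P] → IntegrableOn
      (fun u : ℝ => (P.real (Ico 1 u) : ℂ) * (u : ℂ) ^ (-s - 1)) (Ioi 1) := by
    intro P _
    refine (integrableOn_Ioi_cpow_of_lt hre one_pos).bdd_mul (c := P.real univ) ?_ ?_
    · have : Monotone fun u : ℝ => P.real (Ico 1 u) :=
        fun u v h => measureReal_mono (Ico_subset_Ico_right h)
      exact (Complex.measurable_ofReal.comp this.measurable).aestronglyMeasurable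
    · filter_upwards with u
      rw [Complex.norm_real, Real.norm_of_nonneg measureReal_nonneg]
      exact measureReal_mono (subset_univ _)
  have hset : mellinStieltjesUpTo hA s X = ∫ x in Ici (1 : ℝ), (x : ℂ) ^ (-s) ∂j.posPart -
      ∫ x in Ici (1 : ℝ), (x : ℂ) ^ (-s) ∂j.negPart := by
    change ∫ᵛ x in Ici (1 : ℝ), (x : ℂ) ^ (-s) ∂<•μ = _
    rw [hdec, ← VectorMeasure.integral_indicator measurableSet_Ici,
      VectorMeasure.integral_sub_vectorMeasure, VectorMeasure.integral_toSignedMeasure,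
      VectorMeasure.integral_toSignedMeasure,
      integral_indicator measurableSet_Ici, integral_indicator measurableSet_Ici]
    · rw [VectorMeasure.Integrable, Measure.variation_toSignedMeasure]
      exact (integrable_indicator_iff measurableSet_Ici).2 (hcpow _)
    · rw [VectorMeasure.Integrable, Measure.variation_toSignedMeasure]
      exact (integrable_indicator_iff measurableSet_Ici).2 (hcpow _)
  rw [hset, setIntegral_Ici_cpow_neg _ hs, setIntegral_Ici_cpow_neg _ hs, ← mul_sub,
    ← integral_sub (hIntU _) (hIntU _)]
  congr 1
  apply integral_congr_ae
  rw [EventuallyEq, ae_restrict_iff' measurableSet_Ioi]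
  filter_upwards [hB.locallyBoundedVariationOn.ae_leftLim_eq] with u hu hu1
  have hu1 : 1 < u := hu1
  rw [← sub_mul, ← hu]
  congr 1
  -- The mass of [1, u) is the difference of the left limits at u and at 1. The latter is 0, so a
  -- jump at 1 is counted in full.
  have h1 := hB.vectorMeasure_Ico hu1.le
  rw [leftLim_truncateTo_one hA1, sub_zero, ← hμ,
    SignedMeasure.apply_eq_posPart_real_sub_negPart_real _ measurableSet_Ico] at h1
  rw [← h1]
  push_cast
  rfl

/-- Integration by parts: beyond X the truncation is the constant A(X), and its tail integral is the
boundary term. -/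
theorem mellinStieltjesUpTo_eq {A : ℝ → ℝ} (hA : LocallyBoundedVariationOn A univ)
    (hA1 : ∀ x < 1, A x = 0) {s : ℂ} (hs : 0 < s.re) {X : ℝ} (hX : 1 ≤ X) :
    mellinStieltjesUpTo hA s X = A X * (X : ℂ) ^ (-s) +
      s * ∫ u in Ioc (1 : ℝ) X, (A u : ℂ) * (u : ℂ) ^ (-s - 1) := by
  have hs0 : s ≠ 0 := by rintro rfl; simp at hs
  have hre : (-s - 1).re < -1 := by simp; linarith
  have e1 : EqOn (fun u : ℝ => (truncateTo A 0 X u : ℂ) * (u : ℂ) ^ (-s - 1))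
      (fun u : ℝ => (A u : ℂ) * (u : ℂ) ^ (-s - 1)) (Ioc 1 X) := by
    intro u hu
    simp only [truncateTo]
    rw [min_eq_left hu.2, max_eq_right (by linarith [hu.1])]
  have e2 : EqOn (fun u : ℝ => (truncateTo A 0 X u : ℂ) * (u : ℂ) ^ (-s - 1))
      (fun u : ℝ => (A X : ℂ) * (u : ℂ) ^ (-s - 1)) (Ioi X) := by
    intro u hu
    have hu : X < u := hu
    simp only [truncateTo]
    rw [min_eq_right hu.le, max_eq_right (by linarith)]
  have hpow : IntegrableOn (fun u : ℝ => (u : ℂ) ^ (-s - 1)) (Ioi 1) :=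
    integrableOn_Ioi_cpow_of_lt hre one_pos
  have i1 : IntegrableOn (fun u : ℝ => (A u : ℂ) * (u : ℂ) ^ (-s - 1)) (Ioc 1 X) := by
    obtain ⟨K, hK⟩ := hA.exists_bound_Icc 1 X
    refine (hpow.mono_set Ioc_subset_Ioi_self).bdd_mul (c := K)
      (Complex.measurable_ofReal.comp hA.measurable_univ).aestronglyMeasurable ?_
    rw [ae_restrict_iff' measurableSet_Ioc]
    filter_upwards with u hu
    rw [Complex.norm_real]
    exact hK u ⟨hu.1.le, hu.2⟩
  have i2 : IntegrableOn (fun u : ℝ => (A X : ℂ) * (u : ℂ) ^ (-s - 1)) (Ioi X) :=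
    (hpow.mono_set (Ioi_subset_Ioi hX)).const_mul _
  rw [mellinStieltjesUpTo_eq_integral hA hA1 hs, ← Ioc_union_Ioi_eq_Ioi hX,
    setIntegral_union (Ioc_disjoint_Ioi le_rfl) measurableSet_Ioi
      ((integrableOn_congr_fun e1 measurableSet_Ioc).2 i1)
      ((integrableOn_congr_fun e2 measurableSet_Ioi).2 i2),
    setIntegral_congr_fun measurableSet_Ioc e1, setIntegral_congr_fun measurableSet_Ioi e2,
    integral_const_mul, integral_Ioi_cpow_of_lt hre (by linarith)]
  simp only [sub_add_cancel]
  field_simp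
  ring

theorem integrableOn_Ioc_mul_cpow {A : ℝ → ℝ} (hA : LocallyBoundedVariationOn A univ) (s : ℂ)
    (X : ℝ) : IntegrableOn (fun u : ℝ => (A u : ℂ) * (u : ℂ) ^ s) (Ioc 1 X) := by
  obtain ⟨K, hK⟩ := hA.exists_bound_Icc 1 X
  have hpow : IntegrableOn (fun u : ℝ => (u : ℂ) ^ s) (Ioc 1 X) := by
    refine (ContinuousOn.integrableOn_Icc ?_).mono_set Ioc_subset_Icc_self
    intro u hu
    refine (ContinuousAt.cpow (by fun_prop) (by fun_prop) ?_).continuousWithinAt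
    left
    simpa using (by linarith [hu.1] : (0 : ℝ) < u)
  refine hpow.bdd_mul (c := K)
    (Complex.measurable_ofReal.comp hA.measurable_univ).aestronglyMeasurable ?_
  rw [ae_restrict_iff' measurableSet_Ioc]
  filter_upwards with u hu
  rw [Complex.norm_real]
  exact hK u ⟨hu.1.le, hu.2⟩

theorem mellinStieltjesUpTo_ofReal {A : ℝ → ℝ} (hA : LocallyBoundedVariationOn A univ)
    (hA1 : ∀ x < 1, A x = 0) {σ : ℝ} (hσ : 0 < σ) {X : ℝ} (hX : 1 ≤ X) :
    mellinStieltjesUpTo hA σ X =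
      ((A X * X ^ (-σ) + σ * ∫ u in Ioc (1 : ℝ) X, A u * u ^ (-σ - 1) : ℝ) : ℂ) := by
  rw [mellinStieltjesUpTo_eq hA hA1 (by simpa using hσ) hX]
  push_cast
  rw [← integral_complex_ofReal, Complex.ofReal_cpow (by linarith)]
  congr 2
  · push_cast; rfl
  · apply setIntegral_congr_fun measurableSet_Ioc
    intro u hu
    have : (0 : ℝ) ≤ u := by linarith [hu.1]
    simp only
    push_cast [Complex.ofReal_cpow this]
    rfl

/-- Convergence of the Stieltjes integral of a function bounded below by `-B x` gives absolute
convergence of the associated Lebesgue integral. -/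
theorem integrableOn_mul_rpow_of_mellinStieltjesConvergent {A : ℝ → ℝ}
    (hA : LocallyBoundedVariationOn A univ) (hA1 : ∀ x < 1, A x = 0) {B : ℝ} (hB : 0 ≤ B)
    (hlow : ∀ x, 1 ≤ x → -(B * x) ≤ A x) {σ : ℝ} (hσ : 1 < σ)
    (hconv : MellinStieltjesConvergent hA σ) :
    IntegrableOn (fun u : ℝ => A u * u ^ (-σ - 1)) (Ioi 1) := by
  obtain ⟨L, hL⟩ := hconv
  have hσ0 : 0 < σ := by linarith
  have hpowB : IntegrableOn (fun u : ℝ => B * u ^ (-σ)) (Ioi 1) :=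
    (integrableOn_Ioi_rpow_of_lt (by linarith) one_pos).const_mul B
  have hAint : ∀ X : ℝ, IntegrableOn (fun u : ℝ => A u * u ^ (-σ - 1)) (Ioc 1 X) := by
    intro X
    refine (integrableOn_Ioc_mul_cpow hA ((-σ - 1 : ℝ) : ℂ) X).re.congr ?_
    rw [EventuallyEq, ae_restrict_iff' measurableSet_Ioc]
    filter_upwards with u hu
    have : (0 : ℝ) ≤ u := by linarith [hu.1]
    rw [← Complex.ofReal_cpow this, ← Complex.ofReal_mul]
    exact Complex.ofReal_re _
  have hpos : ∀ u, 1 < u → 0 ≤ A u * u ^ (-σ - 1) + B * u ^ (-σ) := by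
    intro u hu
    have h1 : u ^ (-σ) = u * u ^ (-σ - 1) := by
      rw [Real.rpow_sub_one (by linarith)]
      field_simp
    have := hlow u hu.le
    have h2 : 0 ≤ u ^ (-σ - 1) := Real.rpow_nonneg (by linarith) _
    rw [h1]
    nlinarith
  suffices h : IntegrableOn (fun u : ℝ => A u * u ^ (-σ - 1) + B * u ^ (-σ)) (Ioi 1) by
    refine (h.sub hpowB).congr ?_
    filter_upwards with u
    simp
  -- Adding B u^{-σ} makes the integrand nonnegative, so bounded partial integrals suffice. They are
  -- bounded because the Stieltjes integrals converge and the boundary term A(X)X^{-σ} is at least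
  -- -B.
  refine integrableOn_Ioi_of_intervalIntegral_norm_bounded (l := atTop) (b := id)
    ((‖L‖ + 1 + B) / σ + ∫ u in Ioi (1 : ℝ), B * u ^ (-σ)) 1
    (fun X => (hAint X).add (hpowB.mono_set Ioc_subset_Ioi_self)) tendsto_id ?_
  have hev : ∀ᶠ X in atTop, ‖mellinStieltjesUpTo hA σ X‖ < ‖L‖ + 1 :=
    hL.norm.eventually_lt_const (by linarith)
  filter_upwards [hev, eventually_ge_atTop (1 : ℝ)] with X hX hX1
  rw [mellinStieltjesUpTo_ofReal hA hA1 hσ0 hX1, Complex.norm_real] at hX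
  have hX := (abs_lt.1 hX).2
  rw [id, intervalIntegral.integral_of_le hX1]
  have e : ∫ u in Ioc 1 X, ‖A u * u ^ (-σ - 1) + B * u ^ (-σ)‖ =
      ∫ u in Ioc 1 X, (A u * u ^ (-σ - 1) + B * u ^ (-σ)) := by
    apply setIntegral_congr_fun measurableSet_Ioc
    intro u hu
    exact Real.norm_of_nonneg (hpos u hu.1)
  rw [e, integral_add (hAint X) (hpowB.mono_set Ioc_subset_Ioi_self)]
  gcongr ?_ + ?_
  · rw [le_div_iff₀ hσ0, mul_comm]
    have h3 : -B ≤ A X * X ^ (-σ) := by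
      have h4 := hlow X hX1
      have h5 : 0 ≤ X ^ (-σ) := Real.rpow_nonneg (by linarith) _
      have h6 : X * X ^ (-σ) ≤ 1 := by
        have : X * X ^ (-σ) = X ^ (1 - σ) := by
          rw [sub_eq_add_neg, Real.rpow_add (by linarith), Real.rpow_one]
        rw [this]
        exact Real.rpow_le_one_of_one_le_of_nonpos hX1 (by linarith)
      nlinarith
    linarith
  · refine setIntegral_mono_set hpowB ?_ (LE.le.eventuallyLE Ioc_subset_Ioi_self)
    rw [EventuallyLE, ae_restrict_iff' measurableSet_Ioi]
    filter_upwards with u hu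
    have hu : 1 < u := hu
    exact mul_nonneg hB (Real.rpow_nonneg (by linarith) _)

/-- The Mellin-Stieltjes transform as an absolutely convergent Lebesgue integral. -/
theorem mellinStieltjes_eq_integral {A : ℝ → ℝ}
    (hA : LocallyBoundedVariationOn A univ) (hA1 : ∀ x < 1, A x = 0)
    (hint : ∀ σ : ℝ, 1 < σ → IntegrableOn (fun u : ℝ => A u * u ^ (-σ - 1)) (Ioi 1))
    (hconv : ∀ s : ℂ, 1 < s.re → MellinStieltjesConvergent hA s) {s : ℂ} (hs : 1 < s.re) :
    mellinStieltjes hA s = s * ∫ u in Ioi (1 : ℝ), (A u : ℂ) * (u : ℂ) ^ (-s - 1) := by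
  -- Any exponent strictly between 1 and Re s would do. Convergence at ρ gives A(X)X^{-ρ} a limit,
  -- so the boundary term A(X)X^{-s} tends to 0.
  set ρ : ℝ := (1 + s.re) / 2 with hρ
  have hρ1 : 1 < ρ := by rw [hρ]; linarith
  have hρs : ρ < s.re := by rw [hρ]; linarith
  have hintC : IntegrableOn (fun u : ℝ => (A u : ℂ) * (u : ℂ) ^ (-s - 1)) (Ioi 1) := by
    refine Integrable.mono (hint s.re hs) ?_ ?_
    · exact ((Complex.measurable_ofReal.comp hA.measurable_univ).mul
        (by fun_prop)).aestronglyMeasurable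
    · rw [ae_restrict_iff' measurableSet_Ioi]
      filter_upwards with u hu
      have hu0 : 0 < u := one_pos.trans hu
      rw [norm_mul, norm_mul, Complex.norm_real, Complex.norm_cpow_eq_rpow_re_of_pos hu0,
        Real.norm_of_nonneg (Real.rpow_nonneg hu0.le _)]
      simp
  have hlim : Tendsto (fun X : ℝ => ∫ u in Ioc (1 : ℝ) X, (A u : ℂ) * (u : ℂ) ^ (-s - 1)) atTop
      (𝓝 (∫ u in Ioi (1 : ℝ), (A u : ℂ) * (u : ℂ) ^ (-s - 1))) := by
    refine (intervalIntegral_tendsto_integral_Ioi 1 hintC tendsto_id).congr' ?_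
    filter_upwards [eventually_ge_atTop (1 : ℝ)] with X hX
    rw [id, intervalIntegral.integral_of_le hX]
  obtain ⟨L, hL⟩ := hconv ρ (by simpa using hρ1)
  have hlimρ : Tendsto (fun X : ℝ => ∫ u in Ioc (1 : ℝ) X, A u * u ^ (-ρ - 1)) atTop
      (𝓝 (∫ u in Ioi (1 : ℝ), A u * u ^ (-ρ - 1))) := by
    refine (intervalIntegral_tendsto_integral_Ioi 1 (hint ρ hρ1) tendsto_id).congr' ?_
    filter_upwards [eventually_ge_atTop (1 : ℝ)] with X hX
    rw [id, intervalIntegral.integral_of_le hX]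
  have hAρ : Tendsto (fun X : ℝ => A X * X ^ (-ρ)) atTop
      (𝓝 (L.re - ρ * ∫ u in Ioi (1 : ℝ), A u * u ^ (-ρ - 1))) := by
    have h1 := (Complex.continuous_re.tendsto L).comp hL
    refine (h1.sub (hlimρ.const_mul ρ)).congr' ?_
    filter_upwards [eventually_ge_atTop (1 : ℝ)] with X hX
    rw [Function.comp, mellinStieltjesUpTo_ofReal hA hA1 (by linarith) hX, Complex.ofReal_re]
    ring
  have hA0 : Tendsto (fun X : ℝ => (A X : ℂ) * (X : ℂ) ^ (-s)) atTop (𝓝 0) := by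
    rw [tendsto_zero_iff_norm_tendsto_zero]
    have h1 : Tendsto (fun X : ℝ => X ^ (-(s.re - ρ))) atTop (𝓝 0) :=
      tendsto_rpow_neg_atTop (by linarith)
    have h2 := hAρ.abs.mul h1
    rw [mul_zero] at h2
    refine h2.congr' ?_
    filter_upwards [eventually_gt_atTop (0 : ℝ)] with X hX
    rw [norm_mul, Complex.norm_real, Complex.norm_cpow_eq_rpow_re_of_pos hX, abs_mul, mul_assoc,
      abs_of_nonneg (Real.rpow_nonneg hX.le _), ← Real.rpow_add hX, Complex.neg_re,
      Real.norm_eq_abs]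
    ring_nf
  refine Tendsto.limUnder_eq ?_
  have h3 := hA0.add (hlim.const_mul s)
  rw [zero_add] at h3
  refine h3.congr' ?_
  filter_upwards [eventually_ge_atTop (1 : ℝ)] with X hX
  rw [mellinStieltjesUpTo_eq hA hA1 (by linarith) hX]

/-- In the variable `t = log x`, the function `A(e^t) e^{-t}` has an absolutely
convergent Laplace transform. -/
theorem integrableOn_exp_of_rpow {A : ℝ → ℝ}
    (hint : ∀ σ : ℝ, 1 < σ → IntegrableOn (fun u : ℝ => A u * u ^ (-σ - 1)) (Ioi 1))
    {ε : ℝ} (hε : 0 < ε) :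
    IntegrableOn (fun t : ℝ => A (Real.exp t) * Real.exp (-t) * Real.exp (-(ε * t))) (Ioi 0) := by
  have h := hint (1 + ε) (by linarith)
  have h := (integrableOn_comp_exp_Ioi _ 0).2 (by rwa [Real.exp_zero] :
    IntegrableOn (fun u : ℝ => A u * u ^ (-(1 + ε) - 1)) (Ioi (Real.exp 0)) volume)
  refine h.congr ?_
  filter_upwards with t
  rw [smul_eq_mul, ← Real.exp_mul]
  have : Real.exp t * (A (Real.exp t) * Real.exp (t * (-(1 + ε) - 1))) =
      A (Real.exp t) * (Real.exp t * Real.exp (t * (-(1 + ε) - 1))) := by ring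
  rw [this, mul_assoc, ← Real.exp_add, ← Real.exp_add]
  ring_nf

theorem mellinStieltjes_div_eq_laplace {A : ℝ → ℝ}
    (hA : LocallyBoundedVariationOn A univ) (hA1 : ∀ x < 1, A x = 0)
    (hint : ∀ σ : ℝ, 1 < σ → IntegrableOn (fun u : ℝ => A u * u ^ (-σ - 1)) (Ioi 1))
    (hconv : ∀ s : ℂ, 1 < s.re → MellinStieltjesConvergent hA s) {s : ℂ} (hs : 0 < s.re) :
    mellinStieltjes hA (s + 1) / (s + 1) =
      ∫ t in Ioi (0 : ℝ), ((A (Real.exp t) * Real.exp (-t) : ℝ) : ℂ) * Complex.exp (-(s * t)) := by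
  have hs1 : s + 1 ≠ 0 := by
    intro h
    have := congrArg Complex.re h
    simp at this
    linarith
  rw [mellinStieltjes_eq_integral hA hA1 hint hconv (by simpa using hs), mul_div_cancel_left₀ _ hs1,
    ← Real.exp_zero, ← integral_comp_exp_Ioi]
  apply setIntegral_congr_fun measurableSet_Ioi
  intro t _
  have h0 : (t : ℂ) = Complex.log (Complex.exp t) := by
    rw [← Complex.ofReal_exp, ← Complex.ofReal_log (Real.exp_pos t).le, Real.log_exp]
  have h1 : ((Real.exp t : ℝ) : ℂ) ^ (-(s + 1) - 1) = Complex.exp (t * (-(s + 1) - 1)) := by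
    rw [Complex.cpow_def_of_ne_zero (by exact_mod_cast (Real.exp_pos t).ne'),
      Complex.ofReal_exp, ← h0]
  simp only
  rw [h1, Complex.real_smul]
  push_cast
  have h2 : Complex.exp t * (A (Real.exp t) * Complex.exp (t * (-(s + 1) - 1))) =
      A (Real.exp t) * (Complex.exp t * Complex.exp (t * (-(s + 1) - 1))) := by ring
  rw [h2, mul_assoc, ← Complex.exp_add, ← Complex.exp_add]
  ring_nf

/-! ### The Fejér kernel: positivity, size and mass -/

/-- The (unnormalised) Fejér kernel `∫_0^T (1 - τ/T) cos(τ v) dτ`. -/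
noncomputable def fejerKernel (T v : ℝ) : ℝ := ∫ τ in (0 : ℝ)..T, (1 - τ / T) * Real.cos (τ * v)

theorem fejerKernel_neg (T v : ℝ) : fejerKernel T (-v) = fejerKernel T v := by
  simp [fejerKernel]

theorem fejerKernel_eq {T : ℝ} (hT : 0 < T) {v : ℝ} (hv : v ≠ 0) :
    fejerKernel T v = (1 - Real.cos (T * v)) / (T * v ^ 2) := by
  have hd : ∀ τ ∈ uIcc 0 T, HasDerivAt
      (fun τ => (1 - τ / T) * (Real.sin (τ * v) / v) - Real.cos (τ * v) / (T * v ^ 2))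
      ((1 - τ / T) * Real.cos (τ * v)) τ := by
    intro τ _
    have h1 : HasDerivAt (fun τ : ℝ => τ * v) v τ := by simpa using (hasDerivAt_id τ).mul_const v
    have h2 := (h1.sin.div_const v)
    have h3 := (h1.cos.div_const (T * v ^ 2))
    have h4 : HasDerivAt (fun τ : ℝ => 1 - τ / T) (-(1 / T)) τ := by
      simpa using ((hasDerivAt_id τ).div_const T).const_sub 1
    convert! (h4.mul h2).sub h3 using 1
    field_simp
    ring
  rw [fejerKernel, intervalIntegral.integral_eq_sub_of_hasDerivAt hd
    (Continuous.intervalIntegrable (by fun_prop) _ _)]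
  field_simp
  simp
  ring

theorem continuous_fejerKernel (T : ℝ) : Continuous (fejerKernel T) := by
  unfold fejerKernel
  exact intervalIntegral.continuous_parametric_intervalIntegral_of_continuous' (by fun_prop) 0 T

theorem fejerKernel_zero {T : ℝ} (hT : 0 < T) : fejerKernel T 0 = T / 2 := by
  have : ∀ τ ∈ uIcc 0 T, HasDerivAt (fun τ => τ - τ ^ 2 / (2 * T)) (1 - τ / T) τ := by
    intro τ _
    convert! (hasDerivAt_id τ).sub (((hasDerivAt_id τ).pow 2).div_const (2 * T)) using 1
    simp
    field_simp
  simp only [fejerKernel, mul_zero, Real.cos_zero, mul_one]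
  rw [intervalIntegral.integral_eq_sub_of_hasDerivAt this
    (Continuous.intervalIntegrable (by fun_prop) _ _)]
  field_simp
  ring

theorem fejerKernel_nonneg {T : ℝ} (hT : 0 < T) (v : ℝ) : 0 ≤ fejerKernel T v := by
  rcases eq_or_ne v 0 with rfl | hv
  · rw [fejerKernel_zero hT]; positivity
  · rw [fejerKernel_eq hT hv]
    have := Real.cos_le_one (T * v)
    exact div_nonneg (by linarith) (by positivity)

theorem fejerKernel_le {T : ℝ} (hT : 0 < T) (v : ℝ) : fejerKernel T v ≤ T / 2 := by
  rw [← fejerKernel_zero hT, fejerKernel, fejerKernel]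
  refine intervalIntegral.integral_mono_on hT.le (Continuous.intervalIntegrable (by fun_prop) _ _)
    (Continuous.intervalIntegrable (by fun_prop) _ _) fun τ hτ => ?_
  have h1 : 0 ≤ 1 - τ / T := by
    rw [sub_nonneg, div_le_one hT]; exact hτ.2
  simpa using mul_le_mul_of_nonneg_left (Real.cos_le_one (τ * v)) h1

theorem fejerKernel_le_div {T : ℝ} (hT : 0 < T) {v : ℝ} (hv : v ≠ 0) :
    fejerKernel T v ≤ 2 / T * |v| ^ (-2 : ℝ) := by
  rw [fejerKernel_eq hT hv, Real.rpow_neg (abs_nonneg _), Real.rpow_two, sq_abs]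
  have := Real.neg_one_le_cos (T * v)
  have hv2 : 0 < v ^ 2 := by positivity
  rw [div_mul_eq_mul_div, ← div_eq_mul_inv, div_div, mul_comm (v ^ 2)]
  gcongr
  linarith

/-- For |v| ≤ 1/T every cosine in the defining integral is at least 1/2, so the kernel keeps half of
its value at 0. -/
theorem le_fejerKernel {T : ℝ} (hT : 0 < T) {v : ℝ} (hv : |v| ≤ 1 / T) :
    T / 4 ≤ fejerKernel T v := by
  have h0 : T / 4 = ∫ τ in (0 : ℝ)..T, (1 - τ / T) * (1 / 2) := by
    have := fejerKernel_zero hT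
    simp only [fejerKernel, mul_zero, Real.cos_zero, mul_one] at this
    rw [intervalIntegral.integral_mul_const, this]
    ring
  rw [h0, fejerKernel]
  refine intervalIntegral.integral_mono_on hT.le (Continuous.intervalIntegrable (by fun_prop) _ _)
    (Continuous.intervalIntegrable (by fun_prop) _ _) fun τ hτ => ?_
  have h1 : 0 ≤ 1 - τ / T := by
    rw [sub_nonneg, div_le_one hT]; exact hτ.2
  refine mul_le_mul_of_nonneg_left ?_ h1
  have h2 := Real.one_sub_sq_div_two_le_cos (x := τ * v)
  have h3 : |τ * v| ≤ 1 := by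
    rw [abs_mul, abs_of_nonneg hτ.1]
    calc τ * |v| ≤ T * (1 / T) := mul_le_mul hτ.2 hv (abs_nonneg _) hT.le
      _ = 1 := by field_simp
  have h4 : (τ * v) ^ 2 ≤ 1 := (sq_le_one_iff_abs_le_one _).2 h3
  linarith

theorem integrableOn_compl_Icc_abs_rpow {δ : ℝ} (hδ : 0 < δ) :
    IntegrableOn (fun v : ℝ => |v| ^ (-2 : ℝ)) (Icc (-δ) δ)ᶜ ∧
      ∫ v in (Icc (-δ) δ)ᶜ, |v| ^ (-2 : ℝ) = 2 / δ := by
  have hc : (Icc (-δ) δ)ᶜ = Iio (-δ) ∪ Ioi δ := by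
    ext v
    simp only [mem_compl_iff, mem_Icc, mem_union, mem_Iio, mem_Ioi, not_and_or, not_le]
  have e1 : EqOn (fun v : ℝ => |v| ^ (-2 : ℝ)) (fun v => v ^ (-2 : ℝ)) (Ioi δ) := by
    intro v hv
    simp only
    rw [abs_of_pos (hδ.trans hv)]
  have i1 : IntegrableOn (fun v : ℝ => |v| ^ (-2 : ℝ)) (Ioi δ) :=
    (integrableOn_congr_fun e1 measurableSet_Ioi).2
      (integrableOn_Ioi_rpow_of_lt (by norm_num) hδ)
  have v1 : ∫ v in Ioi δ, |v| ^ (-2 : ℝ) = 1 / δ := by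
    rw [setIntegral_congr_fun measurableSet_Ioi e1, integral_Ioi_rpow_of_lt (by norm_num) hδ]
    norm_num
    rw [Real.rpow_neg_one]
  have i2 : IntegrableOn (fun v : ℝ => |v| ^ (-2 : ℝ)) (Iio (-δ)) := by
    have h : IntegrableOn (fun v : ℝ => |(-v)| ^ (-2 : ℝ)) (Iio (-δ)) := by
      refine IntegrableOn.comp_neg_Iio (f := fun v : ℝ => |v| ^ (-2 : ℝ)) ?_
      rwa [neg_neg]
    simpa only [abs_neg] using h
  have v2 : ∫ v in Iio (-δ), |v| ^ (-2 : ℝ) = 1 / δ := by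
    rw [← integral_Iic_eq_integral_Iio, ← v1, ← integral_comp_neg_Ioi]
    simp
  rw [hc]
  refine ⟨i2.union i1, ?_⟩
  rw [setIntegral_union _ measurableSet_Ioi i2 i1, v1, v2]
  · ring
  · rw [Set.disjoint_left]
    intro v hv hv'
    have h1 : v < -δ := hv
    have h2 : δ < v := hv'
    linarith

theorem integrable_fejerKernel {T : ℝ} (hT : 0 < T) : Integrable (fejerKernel T) := by
  rw [← integrableOn_univ, ← union_compl_self (Icc (-1 : ℝ) 1)]
  refine ((continuous_fejerKernel T).integrableOn_Icc).union ?_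
  refine Integrable.mono' ((integrableOn_compl_Icc_abs_rpow one_pos).1.const_mul (2 / T))
    (continuous_fejerKernel T).aestronglyMeasurable ?_
  rw [ae_restrict_iff' measurableSet_Icc.compl]
  filter_upwards with v hv
  rw [Real.norm_of_nonneg (fejerKernel_nonneg hT v)]
  refine fejerKernel_le_div hT ?_
  rintro rfl
  exact hv (by simp)

theorem setIntegral_compl_fejerKernel_le {T δ : ℝ} (hT : 0 < T) (hδ : 0 < δ) :
    ∫ v in (Icc (-δ) δ)ᶜ, fejerKernel T v ≤ 4 / (T * δ) := by
  obtain ⟨h1, h2⟩ := integrableOn_compl_Icc_abs_rpow hδ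
  calc ∫ v in (Icc (-δ) δ)ᶜ, fejerKernel T v ≤ ∫ v in (Icc (-δ) δ)ᶜ, 2 / T * |v| ^ (-2 : ℝ) := by
        refine setIntegral_mono_on (integrable_fejerKernel hT).integrableOn (h1.const_mul _)
          measurableSet_Icc.compl fun v hv => fejerKernel_le_div hT ?_
        rintro rfl
        exact hv (by simp [hδ.le])
    _ = 4 / (T * δ) := by
        rw [integral_const_mul, h2]
        field_simp
        ring

theorem setIntegral_Icc_fejerKernel_ge {T δ : ℝ} (hT : 0 < T) (hδ : 1 / T ≤ δ) :
    1 / 2 ≤ ∫ v in Icc (-δ) δ, fejerKernel T v := by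
  have hT' : 0 < 1 / T := by positivity
  calc (1 / 2 : ℝ) = ∫ v in Icc (-(1 / T)) (1 / T), T / 4 := by
        rw [setIntegral_const, Real.volume_real_Icc_of_le (by linarith), smul_eq_mul]
        field_simp
        norm_num
    _ ≤ ∫ v in Icc (-(1 / T)) (1 / T), fejerKernel T v := by
        refine setIntegral_mono_on (by simp) (integrable_fejerKernel hT).integrableOn
          measurableSet_Icc fun v hv => le_fejerKernel hT (abs_le.2 hv)
    _ ≤ ∫ v in Icc (-δ) δ, fejerKernel T v := by
        refine setIntegral_mono_set (integrable_fejerKernel hT).integrableOn ?_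
          (LE.le.eventuallyLE (Icc_subset_Icc (by linarith) hδ))
        filter_upwards with v using fejerKernel_nonneg hT v

/-- A crude bound: mass at most 1 from |v| ≤ 1/T and at most 4 from the tails. -/
theorem integral_fejerKernel_le {T : ℝ} (hT : 0 < T) : ∫ v, fejerKernel T v ≤ 5 := by
  have hT' : 0 < 1 / T := by positivity
  rw [← integral_add_compl (s := Icc (-(1 / T)) (1 / T)) measurableSet_Icc
    (integrable_fejerKernel hT)]
  have h1 := setIntegral_compl_fejerKernel_le hT hT'
  have h2 : ∫ v in Icc (-(1 / T)) (1 / T), fejerKernel T v ≤ 1 := by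
    calc _ ≤ ∫ v in Icc (-(1 / T)) (1 / T), T / 2 :=
          setIntegral_mono_on (integrable_fejerKernel hT).integrableOn (by simp)
            measurableSet_Icc fun v _ => fejerKernel_le hT v
      _ = 1 := by
          rw [setIntegral_const, Real.volume_real_Icc_of_le (by linarith), smul_eq_mul]
          field_simp
          norm_num
  have h3 : 4 / (T * (1 / T)) = 4 := by field_simp
  linarith

/-! ### Fejér means in terms of the Fourier transform -/

theorem continuous_integral_mul_cexp {H : ℝ → ℝ} (hH : Integrable H) :
    Continuous fun τ : ℝ => ∫ t, (H t : ℂ) * Complex.exp (-(Complex.I * τ * t)) := by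
  refine continuous_of_dominated (bound := fun t => |H t|) ?_ ?_ hH.abs ?_
  · intro τ
    exact hH.ofReal.aestronglyMeasurable.mul
      (by fun_prop : Continuous fun t : ℝ =>
        Complex.exp (-(Complex.I * τ * t))).aestronglyMeasurable
  · intro τ
    filter_upwards with t
    rw [norm_mul, Complex.norm_real, Complex.norm_exp]
    simp
  · filter_upwards with t
    fun_prop

/-- The convolution with the Fejér kernel is controlled by the Fourier transform on `[0, T]`. -/
theorem abs_integral_mul_fejerKernel_le {H : ℝ → ℝ} (hH : Integrable H) {T : ℝ} (hT : 0 < T)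
    (p : ℝ) : |∫ t, H t * fejerKernel T (p - t)| ≤
      ∫ τ in (0 : ℝ)..T, ‖∫ t, (H t : ℂ) * Complex.exp (-(Complex.I * τ * t))‖ := by
  have hHC : Integrable (fun t => (H t : ℂ)) := hH.ofReal
  have hprod : Integrable (Function.uncurry fun t τ : ℝ =>
      H t * ((1 - τ / T) * Real.cos (τ * (p - t)))) (volume.prod (volume.restrict (Ioc 0 T))) := by
    have h1 : Integrable (fun q : ℝ × ℝ => H q.1) (volume.prod (volume.restrict (Ioc 0 T))) :=
      hH.comp_fst _
    refine h1.mono ?_ ?_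
    · exact h1.aestronglyMeasurable.mul
        (by fun_prop : Continuous fun q : ℝ × ℝ =>
          (1 - q.2 / T) * Real.cos (q.2 * (p - q.1))).aestronglyMeasurable
    · have h2 : ∀ᵐ q : ℝ × ℝ ∂(volume.prod (volume.restrict (Ioc 0 T))), q.2 ∈ Ioc 0 T :=
        Measure.quasiMeasurePreserving_snd.ae (ae_restrict_mem measurableSet_Ioc)
      filter_upwards [h2] with q hq
      rw [Function.uncurry, norm_mul]
      refine mul_le_of_le_one_right (norm_nonneg _) ?_
      rw [norm_mul]
      have h3 : q.2 / T ≤ 1 := (div_le_one hT).2 hq.2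
      have h4 : 0 ≤ q.2 / T := div_nonneg hq.1.le hT.le
      refine mul_le_one₀ ?_ (norm_nonneg _) (Real.abs_cos_le_one _)
      rw [Real.norm_of_nonneg (by linarith)]
      linarith
  have hswap : ∫ t, H t * fejerKernel T (p - t) = ∫ τ in Ioc 0 T, ∫ t,
      H t * ((1 - τ / T) * Real.cos (τ * (p - t))) := by
    rw [← integral_integral_swap hprod]
    congr 1
    ext t
    rw [fejerKernel, intervalIntegral.integral_of_le hT.le, integral_const_mul]
  have hcont := (continuous_integral_mul_cexp hH).norm
  rw [hswap, intervalIntegral.integral_of_le hT.le, ← Real.norm_eq_abs]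
  refine norm_integral_le_of_norm_le (g := fun τ : ℝ =>
    ‖∫ t, (H t : ℂ) * Complex.exp (-(Complex.I * τ * t))‖) ?_ ?_
  · exact (hcont.integrableOn_Icc (a := 0) (b := T)).mono_set Ioc_subset_Icc_self
  rw [ae_restrict_iff' measurableSet_Ioc]
  filter_upwards with τ hτ
  have h3 : τ / T ≤ 1 := (div_le_one hT).2 hτ.2
  have h4 : 0 ≤ τ / T := div_nonneg hτ.1.le hT.le
  have hint : Integrable fun t : ℝ => (H t : ℂ) * Complex.exp (-(Complex.I * τ * t)) := by
    refine hHC.mul_bdd (c := 1) (by fun_prop : Continuous fun t : ℝ =>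
          Complex.exp (-(Complex.I * τ * t))).aestronglyMeasurable ?_
    filter_upwards with t
    rw [Complex.norm_exp]
    simp
  -- The cosine is the real part of e^{iτp}e^{-iτt}. The unimodular factor e^{iτp} drops out of the
  -- norm, so the bound does not depend on the centre p.
  have hre : ∫ t, H t * ((1 - τ / T) * Real.cos (τ * (p - t))) = (1 - τ / T) *
      (Complex.exp (Complex.I * τ * p) *
        ∫ t, (H t : ℂ) * Complex.exp (-(Complex.I * τ * t))).re := by
    have e := integral_re (𝕜 := ℂ) (hint.const_mul (Complex.exp (Complex.I * τ * p)))
    simp only [RCLike.re_eq_complex_re] at e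
    rw [← integral_const_mul (Complex.exp (Complex.I * τ * p)), ← e,
      ← integral_const_mul (1 - τ / T)]
    congr 1
    ext t
    have : Complex.exp (Complex.I * τ * p) * ((H t : ℂ) * Complex.exp (-(Complex.I * τ * t))) =
        (H t : ℂ) * Complex.exp ((τ * (p - t) : ℝ) * Complex.I) := by
      rw [mul_left_comm, ← Complex.exp_add]
      push_cast
      ring_nf
    rw [this, Complex.re_ofReal_mul, Complex.exp_ofReal_mul_I_re]
    ring
  rw [hre, norm_mul, Real.norm_of_nonneg (by linarith)]
  calc _ ≤ 1 * ‖Complex.exp (Complex.I * τ * p) *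
        ∫ t, (H t : ℂ) * Complex.exp (-(Complex.I * τ * t))‖ := by
        refine mul_le_mul (by linarith) (Complex.abs_re_le_norm _) (norm_nonneg _) zero_le_one
    _ = _ := by
        rw [one_mul, norm_mul, Complex.norm_exp]
        simp

theorem integral_mul_fejerKernel_sub (H : ℝ → ℝ) (T p : ℝ) :
    ∫ t, H t * fejerKernel T (p - t) = ∫ v, H (p - v) * fejerKernel T v := by
  rw [← integral_sub_left_eq_self _ volume p]
  simp

theorem integrable_mul_fejerKernel {H : ℝ → ℝ} (hH : Integrable H) {T : ℝ} (hT : 0 < T) (p : ℝ) :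
    Integrable fun v => H (p - v) * fejerKernel T v := by
  refine (hH.comp_sub_left p).mul_bdd (c := T / 2)
    (continuous_fejerKernel T).aestronglyMeasurable ?_
  filter_upwards with v
  rw [Real.norm_of_nonneg (fejerKernel_nonneg hT v)]
  exact fejerKernel_le hT v

/-! ### Tauberian steps and their iteration -/

/-- A one-sided slow-decrease condition to the right of `s` turns a bound for the Fejér mean centred
at `s + δ` into an upper bound at `s`. -/
theorem le_of_fejer_mean_le {H : ℝ → ℝ} (hH : Integrable H) {T η α V S δ d s : ℝ} (hT : 0 < T)
    (hδ : 1 / T ≤ δ) (hd : 4 * δ ≤ d) (hη0 : 0 ≤ η) (hV0 : 0 ≤ V) (hS0 : 0 ≤ S)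
    (hS : ∀ t, -S ≤ H t) (hV : ∀ t, |t - s| ≤ d / 2 → -V ≤ H t)
    (hα : ∀ t ∈ Icc s (s + 2 * δ), H s - α ≤ H t)
    (hη : ∫ t, H t * fejerKernel T (s + δ - t) ≤ η) :
    H s ≤ α + 2 * (η + V * (4 / (T * δ)) + S * (16 / (T * d))) := by
  have hδ0 : 0 < δ := lt_of_lt_of_le (by positivity) hδ
  have hd0 : 0 < d := by linarith
  have hrhs : 0 ≤ η + V * (4 / (T * δ)) + S * (16 / (T * d)) := by positivity
  rcases le_or_gt (H s - α) 0 with h | h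
  · linarith
  have hk := integrable_fejerKernel hT
  rw [integral_mul_fejerKernel_sub] at hη
  set k := fejerKernel T
  set I := Icc (-δ) δ
  set I' := Icc (-(d / 4)) (d / 4)
  have i1 : Integrable (I.indicator k) := hk.indicator measurableSet_Icc
  have i2 : Integrable (Iᶜ.indicator k) := hk.indicator measurableSet_Icc.compl
  have i3 : Integrable (I'ᶜ.indicator k) := hk.indicator measurableSet_Icc.compl
  have i12 : Integrable fun v => (H s - α) * I.indicator k v - V * Iᶜ.indicator k v :=
    (i1.const_mul _).sub (i2.const_mul _)
  -- A minorant with three zones: H(s) - α for |v| ≤ δ, -V out to d/4, and at worst -V - S beyond.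
  -- Since 4δ ≤ d, the middle zone stays within d/2 of s.
  have hle : ∫ v, ((H s - α) * I.indicator k v - V * Iᶜ.indicator k v - S * I'ᶜ.indicator k v) ≤
      ∫ v, H (s + δ - v) * k v := by
    refine integral_mono (i12.sub (i3.const_mul _))
      (integrable_mul_fejerKernel hH hT _) fun v => ?_
    have hkv : 0 ≤ k v := fejerKernel_nonneg hT v
    simp only
    by_cases h1 : v ∈ I
    · have h2 : v ∈ I' := ⟨by linarith [h1.1], by linarith [h1.2]⟩
      rw [indicator_of_mem h1, indicator_of_notMem (notMem_compl_iff.2 h1),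
        indicator_of_notMem (notMem_compl_iff.2 h2)]
      have := hα (s + δ - v) ⟨by linarith [h1.2], by linarith [h1.1]⟩
      nlinarith
    · rw [indicator_of_notMem h1, indicator_of_mem (mem_compl h1)]
      by_cases h2 : v ∈ I'
      · rw [indicator_of_notMem (notMem_compl_iff.2 h2)]
        have := hV (s + δ - v) (abs_le.2 ⟨by linarith [h2.2], by linarith [h2.1]⟩)
        nlinarith
      · rw [indicator_of_mem (mem_compl h2)]
        have := hS (s + δ - v)
        nlinarith [mul_nonneg hV0 hkv]
  rw [integral_sub i12 (i3.const_mul _),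
    integral_sub (i1.const_mul _) (i2.const_mul _), integral_const_mul, integral_const_mul,
    integral_const_mul, integral_indicator measurableSet_Icc,
    integral_indicator measurableSet_Icc.compl, integral_indicator measurableSet_Icc.compl] at hle
  have b1 : 1 / 2 ≤ ∫ v in I, k v := setIntegral_Icc_fejerKernel_ge hT hδ
  have b2 : ∫ v in Iᶜ, k v ≤ 4 / (T * δ) := setIntegral_compl_fejerKernel_le hT hδ0
  have b3 : ∫ v in I'ᶜ, k v ≤ 16 / (T * d) := by
    refine (setIntegral_compl_fejerKernel_le hT (by positivity : 0 < d / 4)).trans_eq ?_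
    field_simp
    norm_num
  have c1 := mul_le_mul_of_nonneg_left b1 h.le
  have c2 := mul_le_mul_of_nonneg_left b2 hV0
  have c3 := mul_le_mul_of_nonneg_left b3 hS0
  linarith

/-- The previous bound applied to -H(-t): the reflection and the sign change together preserve slow
decrease. -/
theorem le_of_fejer_mean_ge {H : ℝ → ℝ} (hH : Integrable H) {T η α V S δ d s : ℝ} (hT : 0 < T)
    (hδ : 1 / T ≤ δ) (hd : 4 * δ ≤ d) (hη0 : 0 ≤ η) (hV0 : 0 ≤ V) (hS0 : 0 ≤ S)
    (hS : ∀ t, H t ≤ S) (hV : ∀ t, |t - s| ≤ d / 2 → H t ≤ V)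
    (hα : ∀ t ∈ Icc (s - 2 * δ) s, H t ≤ H s + α)
    (hη : -η ≤ ∫ t, H t * fejerKernel T (s - δ - t)) :
    -(H s) ≤ α + 2 * (η + V * (4 / (T * δ)) + S * (16 / (T * d))) := by
  have h := le_of_fejer_mean_le (H := fun t => -(H (-t))) (s := -s) (α := α) (hH.comp_neg.neg)
    hT hδ hd hη0 hV0 hS0 (fun t => by linarith [hS (-t)])
    (fun t ht => by
      have := hV (-t) (by rw [← abs_neg]; convert ht using 2; ring)
      linarith)
    (fun t ht => by
      have := hα (-t) ⟨by linarith [ht.2], by linarith [ht.1]⟩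
      simp only [neg_neg]
      linarith) ?_
  · simpa using h
  · rw [← integral_neg_eq_self]
    have : ∀ t, -H (- -t) * fejerKernel T (-s + δ - -t) = -(H t * fejerKernel T (s - δ - t)) := by
      intro t
      rw [neg_neg, ← fejerKernel_neg T (s - δ - t)]
      ring_nf
    simp only [this]
    rw [integral_neg]
    linarith

/-- Iteration of the two one-step bounds over shrinking windows. -/
theorem abs_le_of_fejer_mean_iterate {H : ℝ → ℝ} (hH : Integrable H) {T η α S lo hi : ℝ}
    (hT : 0 < T) (hη0 : 0 ≤ η) (hα0 : 0 ≤ α) (hS : ∀ t, |H t| ≤ S)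
    (hη : ∀ p, |∫ t, H t * fejerKernel T (p - t)| ≤ η)
    (hα : ∀ s t, lo ≤ s → s ≤ t → t ≤ hi → t - s ≤ 64 / T → H s - α ≤ H t) (J : ℕ) :
    ∀ s d : ℝ, 0 < d → lo ≤ s - d → s + d ≤ hi →
      |H s| ≤ 4 / 3 * (α + 2 * η) + 128 * S / (T * d) + S / 4 ^ J := by
  have hS0 : 0 ≤ S := (abs_nonneg _).trans (hS 0)
  induction J with
  | zero =>
    intro s d hd _ _
    have := hS s
    have h1 : 0 ≤ 128 * S / (T * d) := by positivity
    simp only [pow_zero, div_one]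
    linarith
  | succ J ih =>
    intro s d hd hlo hhi
    -- A window too short for δ = 32/T, which needs 4δ ≤ d, is covered by the trivial bound S.
    rcases lt_or_ge (T * d) 128 with hTd | hTd
    · have h1 : S ≤ 128 * S / (T * d) := by
        rw [le_div_iff₀ (by positivity)]
        nlinarith
      have h2 : 0 ≤ S / 4 ^ (J + 1) := by positivity
      have := hS s
      linarith
    set V := 4 / 3 * (α + 2 * η) + 128 * S / (T * (d / 2)) + S / 4 ^ J with hVdef
    have hV0 : 0 ≤ V := by positivity
    have hV : ∀ t, |t - s| ≤ d / 2 → |H t| ≤ V := by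
      intro t ht
      obtain ⟨h1, h2⟩ := abs_le.1 ht
      exact ih t (d / 2) (by linarith) (by linarith) (by linarith)
    have hδ : 1 / T ≤ 32 / T := by gcongr; norm_num
    have hδ0 : 0 < 32 / T := by positivity
    have e64 : 2 * (32 / T) = 64 / T := by ring
    have hd' : 4 * (32 / T) ≤ d := by
      rw [mul_div_assoc', div_le_iff₀ hT]; linarith
    -- With δ = 32/T the previous bound V enters with factor 1/4. Halving d only doubles the S/(Td)
    -- term, so its coefficient becomes 2·128/4 + 32 = 96 ≤ 128, while 4/3 is the fixed point of q ↦
    -- 1 + q/4.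
    have key : α + 2 * (η + V * (4 / (T * (32 / T))) + S * (16 / (T * d))) ≤
        4 / 3 * (α + 2 * η) + 128 * S / (T * d) + S / 4 ^ (J + 1) := by
      have e1 : 4 / (T * (32 / T)) = 1 / 8 := by field_simp; norm_num
      have e2 : 128 * S / (T * (d / 2)) = 16 * (S * (16 / (T * d))) := by field_simp; ring
      have e3 : 128 * S / (T * d) = 8 * (S * (16 / (T * d))) := by field_simp; ring
      have e4 : S / 4 ^ (J + 1) = S / 4 ^ J / 4 := by rw [pow_succ]; field_simp
      have hpos : 0 ≤ S * (16 / (T * d)) := by positivity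
      rw [hVdef, e1, e2, e3, e4]
      linarith
    rw [abs_le']
    constructor
    · refine (le_of_fejer_mean_le hH hT hδ hd' hη0 hV0 hS0 (fun t => (abs_le.1 (hS t)).1)
        (fun t ht => (abs_le.1 (hV t ht)).1) (fun t ht => ?_) (abs_le.1 (hη _)).2).trans key
      exact hα s t (by linarith) ht.1 (by linarith [ht.2]) (by linarith [ht.2])
    · refine (le_of_fejer_mean_ge hH hT hδ hd' hη0 hV0 hS0 (fun t => (abs_le.1 (hS t)).2)
        (fun t ht => (abs_le.1 (hV t ht)).2) (fun t ht => ?_) (abs_le.1 (hη _)).1).trans key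
      have := hα t s (by linarith [ht.1]) ht.2 (by linarith) (by linarith [ht.1])
      linarith

/-- The iterated estimate holds for every J on the same window, so J → ∞ removes S/4^J. -/
theorem abs_le_of_fejer_mean {H : ℝ → ℝ} (hH : Integrable H) {T η α S lo hi : ℝ}
    (hT : 0 < T) (hη0 : 0 ≤ η) (hα0 : 0 ≤ α) (hS : ∀ t, |H t| ≤ S)
    (hη : ∀ p, |∫ t, H t * fejerKernel T (p - t)| ≤ η)
    (hα : ∀ s t, lo ≤ s → s ≤ t → t ≤ hi → t - s ≤ 64 / T → H s - α ≤ H t)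
    {s d : ℝ} (hd : 0 < d) (hlo : lo ≤ s - d) (hhi : s + d ≤ hi) :
    |H s| ≤ 4 / 3 * (α + 2 * η) + 128 * S / (T * d) := by
  have h1 : Tendsto (fun J : ℕ => 4 / 3 * (α + 2 * η) + 128 * S / (T * d) + S / 4 ^ J) atTop
      (𝓝 (4 / 3 * (α + 2 * η) + 128 * S / (T * d) + 0)) := by
    refine tendsto_const_nhds.add ?_
    have := (tendsto_pow_atTop_nhds_zero_of_lt_one (r := (1 / 4 : ℝ)) (by norm_num)
      (by norm_num)).const_mul S
    rw [mul_zero] at this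
    refine this.congr fun J => ?_
    rw [one_div, inv_pow, div_eq_mul_inv]
  rw [add_zero] at h1
  exact ge_of_tendsto' h1 fun J =>
    abs_le_of_fejer_mean_iterate hH hT hη0 hα0 hS hη hα J s d hd hlo hhi

/-! ### The exponential weight -/

/-- The weight `e^{-t/y} - e^{-2t/y}`. -/
noncomputable def expWeight (y t : ℝ) : ℝ := Real.exp (-(t / y)) - Real.exp (-(2 * t / y))

theorem expWeight_eq (y t : ℝ) :
    expWeight y t = Real.exp (-(t / y)) * (1 - Real.exp (-(t / y))) := by
  rw [expWeight, mul_sub, mul_one, ← Real.exp_add]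
  ring_nf

theorem expWeight_nonneg {y t : ℝ} (hy : 0 < y) (ht : 0 ≤ t) : 0 ≤ expWeight y t := by
  rw [expWeight_eq]
  have : Real.exp (-(t / y)) ≤ 1 := Real.exp_le_one_iff.2 (neg_nonpos.2 (by positivity))
  exact mul_nonneg (Real.exp_pos _).le (by linarith)

theorem expWeight_le_one {y t : ℝ} (hy : 0 < y) (ht : 0 ≤ t) : expWeight y t ≤ 1 := by
  have h1 : Real.exp (-(t / y)) ≤ 1 := Real.exp_le_one_iff.2 (neg_nonpos.2 (by positivity))
  have := Real.exp_pos (-(2 * t / y))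
  rw [expWeight]
  linarith

/-- Of the factors e^{-t/y} and 1 - e^{-t/y} only the first decreases, and it does so at relative
rate 1/y. -/
theorem expWeight_ge_mul {y s t : ℝ} (hy : 0 < y) (hs : 0 ≤ s) (hst : s ≤ t) :
    (1 - (t - s) / y) * expWeight y s ≤ expWeight y t := by
  have h0 := expWeight_nonneg hy hs
  have e1 : Real.exp (-(t / y)) = Real.exp (-((t - s) / y)) * Real.exp (-(s / y)) := by
    rw [← Real.exp_add]; ring_nf
  have h1 : 1 - (t - s) / y ≤ Real.exp (-((t - s) / y)) := Real.one_sub_le_exp_neg _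
  have h2 : Real.exp (-(t / y)) ≤ Real.exp (-(s / y)) := by gcongr
  calc (1 - (t - s) / y) * expWeight y s ≤ Real.exp (-((t - s) / y)) * expWeight y s := by gcongr
    _ = Real.exp (-(t / y)) * (1 - Real.exp (-(s / y))) := by rw [expWeight_eq, e1]; ring
    _ ≤ expWeight y t := by
      rw [expWeight_eq]
      gcongr

/-- The weight is v(1 - v) with v = e^{-t/y}, and v lies in [1/5, 2/3] on this window. -/
theorem one_div_eight_le_expWeight {y t : ℝ} (hy : 0 < y) (h1 : y / 2 ≤ t) (h2 : t ≤ 3 * y / 2) :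
    1 / 8 ≤ expWeight y t := by
  have hu1 : 1 / 2 ≤ t / y := by rw [le_div_iff₀ hy]; linarith
  have hu2 : t / y ≤ 3 / 2 := by rw [div_le_iff₀ hy]; linarith
  have b1 : Real.exp (-(t / y)) ≤ 2 / 3 := by
    rw [Real.exp_neg, inv_le_comm₀ (Real.exp_pos _) (by norm_num)]
    have := Real.add_one_le_exp (t / y)
    norm_num
    linarith
  have b2 : 1 / 5 ≤ Real.exp (-(t / y)) := by
    rw [Real.exp_neg, le_inv_comm₀ (by norm_num) (Real.exp_pos _)]
    refine (Real.exp_le_exp.2 hu2).trans ?_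
    have h3 : Real.exp (3 / 2) ^ 2 = Real.exp 1 ^ 3 := by
      rw [← Real.exp_nat_mul, ← Real.exp_nat_mul]; norm_num
    have h4 : Real.exp 1 ^ 3 ≤ 2.7182818286 ^ 3 := by
      gcongr
      exact Real.exp_one_lt_d9.le
    have h5 : Real.exp (3 / 2) ^ 2 ≤ 5 ^ 2 := by
      rw [h3]
      exact h4.trans (by norm_num)
    have h6 := abs_le_of_sq_le_sq h5 (by norm_num)
    rw [one_div, inv_inv]
    exact (le_abs_self _).trans h6
  rw [expWeight_eq]
  nlinarith

theorem abs_expWeight_sub_le {y s t : ℝ} (hy : 1 ≤ y) (hs : 0 ≤ s) (hst : s ≤ t) :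
    |expWeight y t - expWeight y s| ≤ 2 * (t - s) := by
  have hy0 : 0 < y := by linarith
  have key : ∀ c : ℝ, 0 ≤ c → Real.exp (-(c * t / y)) ≤ Real.exp (-(c * s / y)) ∧
      Real.exp (-(c * s / y)) - Real.exp (-(c * t / y)) ≤ c * (t - s) := by
    intro c hc
    refine ⟨by gcongr, ?_⟩
    have e1 : Real.exp (-(c * t / y)) =
        Real.exp (-(c * (t - s) / y)) * Real.exp (-(c * s / y)) := by
      rw [← Real.exp_add]; ring_nf
    have h1 : 1 - c * (t - s) / y ≤ Real.exp (-(c * (t - s) / y)) := Real.one_sub_le_exp_neg _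
    have h2 : Real.exp (-(c * s / y)) ≤ 1 := Real.exp_le_one_iff.2 (neg_nonpos.2 (by positivity))
    have h3 : c * (t - s) / y ≤ c * (t - s) :=
      div_le_self (mul_nonneg hc (by linarith)) hy
    have h4 := Real.exp_pos (-(c * s / y))
    have h5 : 0 ≤ c * (t - s) / y := div_nonneg (mul_nonneg hc (by linarith)) hy0.le
    rw [e1]
    nlinarith
  have k1 := key 1 zero_le_one
  have k2 := key 2 zero_le_two
  simp only [one_mul] at k1
  rw [expWeight, expWeight, abs_le]
  constructor <;> linarith [k1.1, k1.2, k2.1, k2.2]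

/-! ### Tauberian bounds for the weighted difference -/

/-- The weighted difference `(a - r) w` on the positive half-line, extended by zero. -/
noncomputable def weightedDiff (a r : ℝ → ℝ) (y : ℝ) : ℝ → ℝ :=
  (Ioi 0).indicator fun t => (a t - r t) * expWeight y t

theorem weightedDiff_of_pos (a r : ℝ → ℝ) (y : ℝ) {t : ℝ} (ht : 0 < t) :
    weightedDiff a r y t = (a t - r t) * expWeight y t :=
  indicator_of_mem (s := Ioi (0 : ℝ)) ht _

/-- Global upper bound, from the positivity of the kernel. -/
theorem abs_weightedDiff_le {a r : ℝ → ℝ} {y T B K η : ℝ} (hT : 0 < T) (hy : 0 < y)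
    (hTy : 32 ≤ T * y) (hB : 0 ≤ B) (hK : 0 ≤ K)
    (hlow : ∀ t, 0 < t → -B ≤ a t)
    (hmono : ∀ s t, 0 < s → s ≤ t → Real.exp (-(t - s)) * a s - B ≤ a t)
    (hr : ∀ t, 0 < t → |r t| * expWeight y t ≤ K)
    (hH : Integrable (weightedDiff a r y))
    (hη : ∀ p, |∫ t, weightedDiff a r y t * fejerKernel T (p - t)| ≤ η) (t₀ : ℝ) :
    |weightedDiff a r y t₀| ≤ 26 * (Real.exp (1 / T) * (η + K + B)) := by
  have hη0 : 0 ≤ η := (abs_nonneg _).trans (hη 0)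
  have hexp1 : 1 ≤ Real.exp (1 / T) := Real.one_le_exp (by positivity)
  have hprod : η + K + B ≤ Real.exp (1 / T) * (η + K + B) :=
    le_mul_of_one_le_left (by positivity) hexp1
  rcases le_or_gt t₀ 0 with ht₀ | ht₀
  · rw [weightedDiff, indicator_of_notMem (notMem_Ioi.2 ht₀), abs_zero]
    positivity
  set H := weightedDiff a r y with hHdef
  have hw0 := expWeight_nonneg hy ht₀.le
  have hw1 := expWeight_le_one hy ht₀.le
  have hkint := integrable_fejerKernel hT
  have hrw : ∀ t, 0 < t → |r t * expWeight y t| ≤ K := fun t ht => by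
    rw [abs_mul, abs_of_nonneg (expWeight_nonneg hy ht.le)]
    exact hr t ht
  have hge : ∀ t, 0 < t → (a t + B) * expWeight y t ≤ H t + (K + B) := by
    intro t ht
    rw [hHdef, weightedDiff_of_pos a r y ht]
    have h1 := (abs_le.1 (hrw t ht)).2
    have h2 := expWeight_le_one hy ht.le
    nlinarith
  have hnn : ∀ t, 0 ≤ H t + (K + B) := by
    intro t
    rcases le_or_gt t 0 with ht | ht
    · rw [hHdef, weightedDiff, indicator_of_notMem (notMem_Ioi.2 ht)]
      positivity
    · exact (mul_nonneg (by linarith [hlow t ht]) (expWeight_nonneg hy ht.le)).trans (hge t ht)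
  have hupper : a t₀ * expWeight y t₀ ≤ 5 * (Real.exp (1 / T) * (η + 5 * (K + B))) := by
    rcases le_or_gt (a t₀) 0 with ha | ha
    · exact (mul_nonpos_of_nonpos_of_nonneg ha hw0).trans (by positivity)
    have hint1 := integrable_mul_fejerKernel hH hT t₀
    have hsplit : (fun v => (H (t₀ - v) + (K + B)) * fejerKernel T v) =
        fun v => H (t₀ - v) * fejerKernel T v + (K + B) * fejerKernel T v := by
      ext v; ring
    have hint2 : Integrable fun v => (H (t₀ - v) + (K + B)) * fejerKernel T v := by
      rw [hsplit]
      exact hint1.add (hkint.const_mul _)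
    have htot : ∫ v, (H (t₀ - v) + (K + B)) * fejerKernel T v ≤ η + 5 * (K + B) := by
      rw [hsplit, integral_add hint1 (hkint.const_mul _), ← integral_mul_fejerKernel_sub,
        integral_const_mul]
      have h1 := (abs_le.1 (hη t₀)).2
      have h2 := mul_le_mul_of_nonneg_left (integral_fejerKernel_le hT) (add_nonneg hK hB)
      linarith
    have hT' : 0 < 1 / T := by positivity
    set c := T / 4 * (Real.exp (-(1 / T)) * a t₀ * (4 / 5 * expWeight y t₀)) with hc
    -- Over the length 1/T to the right of t₀, a + B stays above e^{-1/T}a(t₀), the weight keeps a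
    -- factor 31/32 ≥ 4/5 because Ty ≥ 32, and the kernel is at least T/4. The remaining part of the
    -- mean is nonnegative and is dropped.
    have hlocal : c * (1 / T) ≤ ∫ v, (H (t₀ - v) + (K + B)) * fejerKernel T v := by
      calc c * (1 / T) = ∫ v in Icc (-(1 / T)) 0, c := by
            rw [setIntegral_const, Real.volume_real_Icc_of_le (by linarith), smul_eq_mul]
            ring
        _ ≤ ∫ v in Icc (-(1 / T)) 0, (H (t₀ - v) + (K + B)) * fejerKernel T v := by
            refine setIntegral_mono_on (by simp) hint2.integrableOn measurableSet_Icc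
              fun v hv => ?_
            have hk : T / 4 ≤ fejerKernel T v :=
              le_fejerKernel hT (abs_le.2 ⟨hv.1, by linarith [hv.2]⟩)
            have hpos : 0 < t₀ - v := by linarith [hv.2]
            have h1 : Real.exp (-(1 / T)) * a t₀ ≤ a (t₀ - v) + B := by
              have h2 := hmono t₀ (t₀ - v) ht₀ (by linarith [hv.2])
              have h3 : Real.exp (-(1 / T)) ≤ Real.exp (-(t₀ - v - t₀)) := by
                gcongr
                linarith [hv.1]
              have := mul_le_mul_of_nonneg_right h3 ha.le
              linarith
            have h4 : 4 / 5 * expWeight y t₀ ≤ expWeight y (t₀ - v) := by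
              refine le_trans ?_ (expWeight_ge_mul hy ht₀.le (by linarith [hv.2]))
              gcongr
              have h5 : (t₀ - v - t₀) / y ≤ 1 / 32 := by
                rw [div_le_iff₀ hy]
                have : 1 / T ≤ 1 / 32 * y := by
                  rw [div_le_iff₀ hT]; linarith
                linarith [hv.1]
              linarith
            have h6 := hge (t₀ - v) hpos
            have h7 : Real.exp (-(1 / T)) * a t₀ * (4 / 5 * expWeight y t₀) ≤
                (a (t₀ - v) + B) * expWeight y (t₀ - v) :=
              mul_le_mul h1 h4 (by positivity) (by linarith [hlow _ hpos])
            rw [hc, mul_comm]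
            exact mul_le_mul (h7.trans h6) hk (by positivity) (hnn _)
        _ ≤ _ := setIntegral_le_integral hint2 (by
            filter_upwards with v using mul_nonneg (hnn _) (fejerKernel_nonneg hT v))
    have h1 : c * (1 / T) = Real.exp (-(1 / T)) * (a t₀ * expWeight y t₀) / 5 := by
      rw [hc]; field_simp
    have h2 : Real.exp (1 / T) * (Real.exp (-(1 / T)) * (a t₀ * expWeight y t₀)) =
        a t₀ * expWeight y t₀ := by
      rw [← mul_assoc, ← Real.exp_add]; simp
    have h3 : Real.exp (-(1 / T)) * (a t₀ * expWeight y t₀) ≤ 5 * (η + 5 * (K + B)) := by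
      linarith
    have h4 := mul_le_mul_of_nonneg_left h3 (Real.exp_pos (1 / T)).le
    linarith
  have h1 := abs_le.1 (hrw t₀ ht₀)
  have h2 : -B ≤ a t₀ * expWeight y t₀ := by
    have := hlow t₀ ht₀
    nlinarith
  rw [hHdef, weightedDiff_of_pos a r y ht₀, sub_mul]
  have h3 : 5 * (Real.exp (1 / T) * (η + 5 * (K + B))) + K ≤
      26 * (Real.exp (1 / T) * (η + K + B)) := by
    nlinarith
  rw [abs_le]
  constructor <;> linarith [h1.1, h1.2]

theorem abs_sub_le_mul_abs_weightedDiff {a r : ℝ → ℝ} {y t : ℝ} (hy : 0 < y) (h1 : y / 2 ≤ t)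
    (h2 : t ≤ 3 * y / 2) : |a t - r t| ≤ 8 * |weightedDiff a r y t| := by
  have := one_div_eight_le_expWeight hy h1 h2
  rw [weightedDiff_of_pos a r y (by linarith), abs_mul, abs_of_nonneg (by linarith :
    0 ≤ expWeight y t)]
  nlinarith [abs_nonneg (a t - r t)]

/-- The local Tauberian estimate. -/
theorem abs_sub_le_of_fejer_mean {a r : ℝ → ℝ} {y T B K η ψ : ℝ} (hT : 1 ≤ T) (hy : 1 ≤ y)
    (hTy : 32 ≤ T * y) (hB : 0 ≤ B) (hK : 0 ≤ K) (hψ : 0 ≤ ψ)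
    (hlow : ∀ t, 0 < t → -B ≤ a t)
    (hmono : ∀ s t, 0 < s → s ≤ t → Real.exp (-(t - s)) * a s - B ≤ a t)
    (hmonoψ : ∀ s t, y / 2 ≤ s → s ≤ t → a s - (t - s) * (|a s| + B) - B * ψ ≤ a t)
    (hr : ∀ t, 0 < t → |r t| * expWeight y t ≤ K)
    (hrlip : ∀ s t, y / 2 ≤ s → s ≤ t → t ≤ 3 * y / 2 → |r t - r s| ≤ K * (t - s))
    (hH : Integrable (weightedDiff a r y))
    (hη : ∀ p, |∫ t, weightedDiff a r y t * fejerKernel T (p - t)| ≤ η) :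
    |a y - r y| ≤ 1500000 * ((η + K + B) / T) + 22 * η + 11 * (B * ψ) := by
  have hT0 : 0 < T := by linarith
  have hy0 : 0 < y := by linarith
  have hη0 : 0 ≤ η := (abs_nonneg _).trans (hη 0)
  set Q := η + K + B with hQ
  have hQ0 : 0 ≤ Q := by positivity
  have hglob : ∀ t, |weightedDiff a r y t| ≤ 78 * Q := by
    intro t
    refine (abs_weightedDiff_le hT0 hy0 hTy hB hK hlow hmono hr hH hη t).trans ?_
    have h1 : Real.exp (1 / T) ≤ 3 := by
      have : 1 / T ≤ 1 := by rw [div_le_one hT0]; exact hT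
      exact (Real.exp_le_exp.2 this).trans Real.exp_one_lt_three.le
    have := mul_le_mul_of_nonneg_right h1 hQ0
    linarith
  have hg : ∀ s, y / 2 ≤ s → s ≤ 3 * y / 2 → |a s - r s| ≤ 624 * Q := by
    intro s h1 h2
    have := abs_sub_le_mul_abs_weightedDiff (a := a) (r := r) hy0 h1 h2
    linarith [hglob s]
  have hrb : ∀ s, y / 2 ≤ s → s ≤ 3 * y / 2 → |r s| ≤ 8 * K := by
    intro s h1 h2
    have h3 := one_div_eight_le_expWeight hy0 h1 h2
    have h4 := hr s (by linarith)
    nlinarith [abs_nonneg (r s)]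
  -- The step length 64/T times a Lipschitz-type constant. That constant is 1872Q + 9K + B, where
  -- 624Q = 8·78Q bounds |a - r| on the window and 2·624Q comes from the variation of the weight.
  set α := 64 / T * (1900 * Q) + B * ψ with hα
  have hslow : ∀ s t, y / 2 ≤ s → s ≤ t → t ≤ 3 * y / 2 → t - s ≤ 64 / T →
      weightedDiff a r y s - α ≤ weightedDiff a r y t := by
    intro s t h1 hst h2 hts
    have hδ : 0 ≤ t - s := by linarith
    rw [weightedDiff_of_pos a r y (by linarith), weightedDiff_of_pos a r y (by linarith)]
    have c1 := hg s h1 (by linarith)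
    have c2 := hrb s h1 (by linarith)
    have c3 : |a s| ≤ 624 * Q + 8 * K := by
      calc |a s| = |(a s - r s) + r s| := by ring_nf
        _ ≤ |a s - r s| + |r s| := abs_add_le _ _
        _ ≤ _ := by linarith
    have c4 := hmonoψ s t h1 hst
    have c5 := (abs_le.1 (hrlip s t h1 hst h2)).2
    have c6 : (a s - r s) - (a t - r t) ≤ (t - s) * (624 * Q + 9 * K + B) + B * ψ := by
      have := mul_le_mul_of_nonneg_left c3 hδ
      nlinarith
    have w0 := expWeight_nonneg hy0 (by linarith : 0 ≤ t)
    have w1 := expWeight_le_one hy0 (by linarith : 0 ≤ t)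
    have w2 := abs_expWeight_sub_le hy (by linarith : 0 ≤ s) hst
    have c7 : ((a s - r s) - (a t - r t)) * expWeight y t ≤
        (t - s) * (624 * Q + 9 * K + B) + B * ψ := by
      have hP : 0 ≤ (t - s) * (624 * Q + 9 * K + B) + B * ψ := by positivity
      calc _ ≤ ((t - s) * (624 * Q + 9 * K + B) + B * ψ) * expWeight y t := by gcongr
        _ ≤ _ := mul_le_of_le_one_right hP w1
    have c8 : |(a s - r s) * (expWeight y t - expWeight y s)| ≤ 624 * Q * (2 * (t - s)) := by
      rw [abs_mul]
      exact mul_le_mul c1 w2 (abs_nonneg _) (by positivity)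
    have c9 := (abs_le.1 c8).1
    have c10 : (t - s) * (1872 * Q + 9 * K + B) ≤ 64 / T * (1900 * Q) := by
      refine mul_le_mul hts ?_ (by positivity) (by positivity)
      have : K ≤ Q := by rw [hQ]; linarith
      have : B ≤ Q := by rw [hQ]; linarith
      linarith
    rw [hα]
    nlinarith
  have hfin := abs_le_of_fejer_mean hH hT0 hη0 (by positivity : 0 ≤ α) hglob hη hslow
    (s := y) (d := y / 2) (by linarith) (by linarith) (by linarith)
  have h1 := abs_sub_le_mul_abs_weightedDiff (a := a) (r := r) hy0 (by linarith : y / 2 ≤ y)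
    (by linarith)
  have h2 : 128 * (78 * Q) / (T * (y / 2)) ≤ 19968 * (Q / T) := by
    have : 128 * (78 * Q) / (T * (y / 2)) = 19968 * (Q / T) / y := by field_simp; ring
    rw [this]
    exact div_le_self (by positivity) hy
  have h3 : 64 / T * (1900 * Q) = 121600 * (Q / T) := by field_simp; ring
  have h4 : 0 ≤ Q / T := by positivity
  have h5 : 0 ≤ B * ψ := by positivity
  rw [hα, h3] at hfin
  linarith

/-! ### Laplace transforms and size of the oscillating terms -/

theorem integrableOn_rpow_mul_exp_neg {ω σ : ℝ} (hω : -1 < ω) (hσ : 0 < σ) :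
    IntegrableOn (fun t : ℝ => t ^ ω * Real.exp (-(σ * t))) (Ioi 0) := by
  have h := integrableOn_rpow_mul_exp_neg_mul_rpow hω one_pos hσ
  simpa only [Real.rpow_one, neg_mul] using h

theorem measurable_rpow_mul_cexp (ω : ℝ) (z : ℂ) :
    Measurable fun t : ℝ => ((t ^ ω : ℝ) : ℂ) * Complex.exp (-(z * t)) := by
  fun_prop

theorem integrableOn_rpow_mul_cexp {ω : ℝ} (hω : -1 < ω) {z : ℂ} (hz : 0 < z.re) :
    IntegrableOn (fun t : ℝ => ((t ^ ω : ℝ) : ℂ) * Complex.exp (-(z * t))) (Ioi 0) := by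
  refine Integrable.mono (integrableOn_rpow_mul_exp_neg hω hz)
    (measurable_rpow_mul_cexp ω z).aestronglyMeasurable ?_
  filter_upwards with t
  rw [norm_mul, norm_mul, Complex.norm_real, Complex.norm_exp,
    Real.norm_of_nonneg (Real.exp_pos _).le]
  simp

theorem differentiableOn_laplace_rpow {ω : ℝ} (hω : -1 < ω) :
    DifferentiableOn ℂ
      (fun z : ℂ => ∫ t in Ioi (0 : ℝ), ((t ^ ω : ℝ) : ℂ) * Complex.exp (-(z * t)))
      {z | 0 < z.re} := by
  intro z hz
  have hz : 0 < z.re := hz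
  refine DifferentiableAt.differentiableWithinAt (HasDerivAt.differentiableAt
    (f' := ∫ t in Ioi (0 : ℝ), ((t ^ ω : ℝ) : ℂ) * (Complex.exp (-(z * t)) * (-t)))
    (hasDerivAt_integral_of_dominated_loc_of_deriv_le
      (F := fun (z : ℂ) (t : ℝ) => ((t ^ ω : ℝ) : ℂ) * Complex.exp (-(z * t)))
      (F' := fun (z : ℂ) (t : ℝ) => ((t ^ ω : ℝ) : ℂ) * (Complex.exp (-(z * t)) * (-t)))
      (bound := fun t : ℝ => t ^ (ω + 1) * Real.exp (-(z.re / 2 * t)))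
      (s := {w | z.re / 2 < w.re}) ?_ ?_ ?_ ?_ ?_ ?_ ?_).2)
  · exact (isOpen_lt continuous_const Complex.continuous_re).mem_nhds (by
      change z.re / 2 < z.re
      linarith)
  · filter_upwards with w using (measurable_rpow_mul_cexp ω w).aestronglyMeasurable
  · exact integrableOn_rpow_mul_cexp hω hz
  · exact (by fun_prop : Measurable fun t : ℝ =>
      ((t ^ ω : ℝ) : ℂ) * (Complex.exp (-(z * t)) * (-t))).aestronglyMeasurable
  · rw [ae_restrict_iff' measurableSet_Ioi]
    filter_upwards with t ht w hw
    have ht : 0 < t := ht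
    have hw : z.re / 2 < w.re := hw
    rw [norm_mul, norm_mul, Complex.norm_real, Complex.norm_exp, norm_neg, Complex.norm_real,
      Real.norm_of_nonneg (Real.rpow_nonneg ht.le _), Real.norm_of_nonneg ht.le,
      Real.rpow_add ht, Real.rpow_one, mul_assoc, mul_comm t]
    gcongr
    simp only [Complex.neg_re, Complex.mul_re, Complex.ofReal_re, Complex.ofReal_im, mul_zero,
      sub_zero]
    nlinarith
  · exact integrableOn_rpow_mul_exp_neg (by linarith) (by linarith)
  · filter_upwards with t w _
    refine HasDerivAt.const_mul _ (HasDerivAt.cexp ?_)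
    simpa using ((hasDerivAt_id w).mul_const (t : ℂ)).fun_neg

/-- The Laplace transform of a power, for complex argument. -/
theorem laplace_rpow {ω : ℝ} (hω : -1 < ω) {z : ℂ} (hz : 0 < z.re) :
    ∫ t in Ioi (0 : ℝ), ((t ^ ω : ℝ) : ℂ) * Complex.exp (-(z * t)) =
      Real.Gamma (ω + 1) / z ^ ((ω : ℂ) + 1) := by
  set U : Set ℂ := {z | 0 < z.re}
  have hU : IsOpen U := isOpen_lt continuous_const Complex.continuous_re
  have hUc : IsPreconnected U := (convex_halfSpace_re_gt 0).isPreconnected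
  have h1 := (differentiableOn_laplace_rpow hω).analyticOnNhd hU
  have h2 : AnalyticOnNhd ℂ (fun z : ℂ => (Real.Gamma (ω + 1) : ℂ) / z ^ ((ω : ℂ) + 1)) U := by
    refine DifferentiableOn.analyticOnNhd (fun w hw => ?_) hU
    have hw : 0 < w.re := hw
    have hw0 : w ≠ 0 := by rintro rfl; simp at hw
    refine DifferentiableAt.differentiableWithinAt ((differentiableAt_const _).div ?_ ?_)
    · exact DifferentiableAt.cpow_const differentiableAt_id (Or.inl hw)
    · exact (Complex.cpow_ne_zero_iff_of_exponent_ne_zero (by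
        intro h
        have := congrArg Complex.re h
        simp at this
        linarith)).2 hw0
  have hreal : ∀ x : ℝ, 0 < x → ∫ t in Ioi (0 : ℝ), ((t ^ ω : ℝ) : ℂ) * Complex.exp (-(x * t)) =
      (Real.Gamma (ω + 1) : ℂ) / (x : ℂ) ^ ((ω : ℂ) + 1) := by
    intro x hx
    have h := Real.integral_rpow_mul_exp_neg_mul_Ioi (a := ω + 1) (by linarith) hx
    rw [add_sub_cancel_right, one_div, Real.inv_rpow hx.le, mul_comm, ← div_eq_mul_inv] at h
    have h' := congrArg (fun u : ℝ => (u : ℂ)) h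
    simp only [← integral_complex_ofReal] at h'
    push_cast [Complex.ofReal_cpow hx.le] at h'
    exact h'
  -- Identity theorem: both sides are analytic in the right half-plane, where the principal power is
  -- holomorphic, and agree on the positive reals.
  refine (h1.eqOn_of_preconnected_of_frequently_eq h2 hUc (z₀ := 1) (by simp) ?_) hz
  have ht : Tendsto (fun x : ℝ => (x : ℂ)) (𝓝[≠] 1) (𝓝[≠] 1) := by
    refine tendsto_nhdsWithin_iff.2 ⟨?_, ?_⟩
    · exact (Complex.continuous_ofReal.tendsto' 1 1 (by simp)).mono_left nhdsWithin_le_nhds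
    · filter_upwards [self_mem_nhdsWithin] with x hx
      simpa using hx
  refine ht.frequently (Eventually.frequently ?_)
  filter_upwards [nhdsWithin_le_nhds (Ioi_mem_nhds (one_pos : (0 : ℝ) < 1))] with x hx
  exact hreal x hx

/-- The term `t^ω / Γ(ω+1) · 2 Re (c e^{-ibt})`. -/
noncomputable def oscTerm (c : ℂ) (b ω t : ℝ) : ℝ :=
  t ^ ω / Real.Gamma (ω + 1) * (2 * (c * Complex.exp (-Complex.I * (b : ℂ) * (t : ℂ))).re)

theorem oscTerm_eq (c : ℂ) (b ω t : ℝ) (s : ℂ) :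
    (oscTerm c b ω t : ℂ) * Complex.exp (-(s * t)) =
      c / Real.Gamma (ω + 1) *
        (((t ^ ω : ℝ) : ℂ) * Complex.exp (-((s + Complex.I * b) * t))) +
      (starRingEnd ℂ) c / Real.Gamma (ω + 1) *
        (((t ^ ω : ℝ) : ℂ) * Complex.exp (-((s - Complex.I * b) * t))) := by
  have h1 : ((2 * (c * Complex.exp (-Complex.I * (b : ℂ) * (t : ℂ))).re : ℝ) : ℂ) =
      c * Complex.exp (-Complex.I * (b : ℂ) * (t : ℂ)) +
        (starRingEnd ℂ) c * Complex.exp (Complex.I * (b : ℂ) * (t : ℂ)) := by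
    rw [← Complex.add_conj, map_mul, ← Complex.exp_conj]
    simp
  have h2 : Complex.exp (-((s + Complex.I * b) * t)) =
      Complex.exp (-Complex.I * (b : ℂ) * (t : ℂ)) * Complex.exp (-(s * t)) := by
    rw [← Complex.exp_add]; ring_nf
  have h3 : Complex.exp (-((s - Complex.I * b) * t)) =
      Complex.exp (Complex.I * (b : ℂ) * (t : ℂ)) * Complex.exp (-(s * t)) := by
    rw [← Complex.exp_add]; ring_nf
  rw [oscTerm, Complex.ofReal_mul, h1, h2, h3]
  push_cast
  ring

theorem laplace_oscTerm (c : ℂ) (b : ℝ) {ω : ℝ} (hω : -1 < ω) {s : ℂ} (hs : 0 < s.re) :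
    IntegrableOn (fun t : ℝ => (oscTerm c b ω t : ℂ) * Complex.exp (-(s * t))) (Ioi 0) ∧
    ∫ t in Ioi (0 : ℝ), (oscTerm c b ω t : ℂ) * Complex.exp (-(s * t)) =
      c / (s + Complex.I * b) ^ ((ω : ℂ) + 1) +
        (starRingEnd ℂ) c / (s - Complex.I * b) ^ ((ω : ℂ) + 1) := by
  have h1 : 0 < (s + Complex.I * b).re := by simpa using hs
  have h2 : 0 < (s - Complex.I * b).re := by simpa using hs
  have i1 := (integrableOn_rpow_mul_cexp hω h1).const_mul (c / Real.Gamma (ω + 1) : ℂ)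
  have i2 := (integrableOn_rpow_mul_cexp hω h2).const_mul
    ((starRingEnd ℂ) c / Real.Gamma (ω + 1) : ℂ)
  have hG : (Real.Gamma (ω + 1) : ℂ) ≠ 0 := by
    exact_mod_cast (Real.Gamma_pos_of_pos (by linarith)).ne'
  simp only [oscTerm_eq]
  refine ⟨i1.add i2, ?_⟩
  rw [integral_add i1 i2, integral_const_mul, integral_const_mul, laplace_rpow hω h1,
    laplace_rpow hω h2]
  field_simp

/-- `1/Γ` is bounded on `(0, Ω + 1]`. -/
theorem exists_inv_Gamma_le (Ω : ℝ) :
    ∃ D : ℝ, 0 ≤ D ∧ ∀ ω, -1 < ω → ω ≤ Ω → (Real.Gamma (ω + 1))⁻¹ ≤ D := by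
  -- Since 1/Γ is entire, compactness of the closed interval [0, Ω + 1] makes the bound uniform as ω
  -- approaches -1.
  have hcont : Continuous fun x : ℝ => (Complex.Gamma x)⁻¹ :=
    Complex.differentiable_one_div_Gamma.continuous.comp Complex.continuous_ofReal
  obtain ⟨D, hD⟩ := (isCompact_Icc (a := (0 : ℝ)) (b := Ω + 1)).exists_bound_of_continuousOn
    hcont.continuousOn
  refine ⟨max D 0, le_max_right _ _, fun ω h1 h2 => ?_⟩
  have h := hD (ω + 1) ⟨by linarith, by linarith⟩
  rw [norm_inv, Complex.Gamma_ofReal, Complex.norm_real,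
    Real.norm_of_nonneg (Real.Gamma_pos_of_pos (by linarith)).le] at h
  exact h.trans (le_max_left _ _)

theorem rpow_le_rpow_max {y ω Ω : ℝ} (hy : 1 ≤ y) (h : ω ≤ Ω) : y ^ ω ≤ y ^ max Ω 0 :=
  Real.rpow_le_rpow_of_exponent_le hy (h.trans (le_max_left _ _))

/-- Scale by u = t/y. For u ≤ 1 the factor 1 - e^{-u} ≤ u absorbs the singularity of u^ω, as ω > -1;
for u ≥ 1 the exponential absorbs the growth, u^N ≤ N! e^u. -/
theorem rpow_mul_expWeight_le {ω Ω y t : ℝ} (h1 : -1 < ω) (h2 : ω ≤ Ω) (hy : 1 ≤ y) (ht : 0 < t) :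
    t ^ ω * expWeight y t ≤ (⌈max Ω 0⌉₊).factorial * y ^ max Ω 0 := by
  have hy0 : 0 < y := by linarith
  set N := ⌈max Ω 0⌉₊
  set u := t / y with hu
  have hu0 : 0 < u := by positivity
  have ht' : t ^ ω = y ^ ω * u ^ ω := by
    rw [← Real.mul_rpow hy0.le hu0.le, hu, mul_div_cancel₀ _ hy0.ne']
  have hfac : (1 : ℝ) ≤ (N.factorial : ℝ) := by exact_mod_cast Nat.factorial_pos N
  have hw : u ^ ω * expWeight y t ≤ N.factorial := by
    rw [expWeight_eq, ← hu]
    have e1 : 1 - Real.exp (-u) ≤ u := by linarith [Real.one_sub_le_exp_neg u]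
    have e2 : 1 - Real.exp (-u) ≤ 1 := by linarith [Real.exp_pos (-u)]
    have e3 : Real.exp (-u) ≤ 1 := Real.exp_le_one_iff.2 (by linarith)
    have e4 := Real.exp_pos (-u)
    rcases le_total u 1 with h | h
    · calc u ^ ω * (Real.exp (-u) * (1 - Real.exp (-u))) ≤ u ^ ω * (1 * u) := by
            gcongr
        _ = u ^ (ω + 1) := by rw [Real.rpow_add hu0, Real.rpow_one, one_mul]
        _ ≤ 1 := Real.rpow_le_one hu0.le h (by linarith)
        _ ≤ _ := hfac
    · have h3 : u ^ ω ≤ u ^ N := by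
        rw [← Real.rpow_natCast]
        exact Real.rpow_le_rpow_of_exponent_le h
          (h2.trans ((le_max_left _ _).trans (Nat.le_ceil _)))
      have h4 : u ^ N ≤ Real.exp u * N.factorial := by
        have := Real.pow_div_factorial_le_exp u hu0.le N
        rwa [div_le_iff₀ (by positivity)] at this
      calc u ^ ω * (Real.exp (-u) * (1 - Real.exp (-u))) ≤
            (Real.exp u * N.factorial) * (Real.exp (-u) * 1) := by
            gcongr
            exact h3.trans h4
        _ = (Real.exp u * Real.exp (-u)) * N.factorial := by ring
        _ = N.factorial := by rw [← Real.exp_add]; simp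
  have hY := rpow_le_rpow_max hy h2
  calc t ^ ω * expWeight y t = y ^ ω * (u ^ ω * expWeight y t) := by rw [ht']; ring
    _ ≤ y ^ max Ω 0 * N.factorial := by
      gcongr
      exact mul_nonneg (by positivity) (expWeight_nonneg hy0 ht.le)
    _ = _ := by ring

theorem rpow_le_of_mem_window {ω Ω y t : ℝ} (h1 : -1 < ω) (h2 : ω ≤ Ω) (hy : 1 ≤ y)
    (ht1 : y / 2 ≤ t) (ht2 : t ≤ 3 * y / 2) :
    t ^ ω ≤ 2 ^ (max Ω 0 + 1) * y ^ max Ω 0 := by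
  have hy0 : 0 < y := by linarith
  have ht : 0 < t := by linarith
  set u := t / y with hu
  have hu0 : 0 < u := by positivity
  have hu1 : 1 / 2 ≤ u := by rw [hu, le_div_iff₀ hy0]; linarith
  have hu2 : u ≤ 2 := by rw [hu, div_le_iff₀ hy0]; linarith
  have ht' : t ^ ω = u ^ ω * y ^ ω := by
    rw [← Real.mul_rpow hu0.le hy0.le, hu, div_mul_cancel₀ _ hy0.ne']
  have hP : 0 ≤ max Ω 0 := le_max_right _ _
  rw [ht']
  refine mul_le_mul ?_ (rpow_le_rpow_max hy h2) (by positivity) (by positivity)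
  rcases le_total 0 ω with h | h
  · calc u ^ ω ≤ 2 ^ ω := Real.rpow_le_rpow hu0.le hu2 h
      _ ≤ _ := Real.rpow_le_rpow_of_exponent_le one_le_two
        (by linarith [le_max_left Ω 0])
  · calc u ^ ω ≤ (1 / 2) ^ ω := Real.rpow_le_rpow_of_nonpos (by norm_num) hu1 h
      _ = 2 ^ (-ω) := by rw [one_div, Real.inv_rpow zero_le_two, Real.rpow_neg zero_le_two]
      _ ≤ _ := Real.rpow_le_rpow_of_exponent_le one_le_two (by linarith)

theorem abs_rpow_sub_rpow_le {ω Ω y s t : ℝ} (h1 : -1 < ω) (h2 : ω ≤ Ω) (hy : 1 ≤ y)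
    (hs : y / 2 ≤ s) (hst : s ≤ t) (ht : t ≤ 3 * y / 2) :
    |t ^ ω - s ^ ω| ≤ (max Ω 0 + 1) * 2 * (2 ^ (max Ω 0 + 1) * y ^ max Ω 0) * (t - s) := by
  have hP : 0 ≤ max Ω 0 := le_max_right _ _
  have hω : |ω| ≤ max Ω 0 + 1 := abs_le.2 ⟨by linarith, by linarith [le_max_left Ω 0]⟩
  have hmem : ∀ x ∈ Icc s t, 0 < x := fun x hx => by linarith [hx.1]
  have := (convex_Icc s t).norm_image_sub_le_of_norm_hasDerivWithin_le
    (f := fun x : ℝ => x ^ ω) (f' := fun x => ω * x ^ (ω - 1))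
    (C := (max Ω 0 + 1) * 2 * (2 ^ (max Ω 0 + 1) * y ^ max Ω 0))
    (fun x hx => (Real.hasDerivAt_rpow_const (Or.inl (hmem x hx).ne')).hasDerivWithinAt)
    (fun x hx => ?_) (left_mem_Icc.2 hst) (right_mem_Icc.2 hst)
  · rwa [Real.norm_eq_abs, Real.norm_of_nonneg (by linarith)] at this
  · have hx0 := hmem x hx
    have h3 := rpow_le_of_mem_window h1 h2 hy (hs.trans hx.1) (hx.2.trans ht)
    rw [norm_mul, Real.norm_eq_abs, Real.norm_of_nonneg (by positivity), Real.rpow_sub_one hx0.ne',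
      mul_assoc]
    have h4 : x ^ ω / x ≤ 2 * (2 ^ (max Ω 0 + 1) * y ^ max Ω 0) := by
      rw [div_le_iff₀ hx0]
      have h5 : 1 ≤ 2 * x := by linarith [hx.1]
      have h6 : 0 ≤ 2 ^ (max Ω 0 + 1) * y ^ max Ω 0 := by positivity
      nlinarith
    exact mul_le_mul hω h4 (by positivity) (by linarith)

theorem abs_two_mul_re_le (c : ℂ) (b t : ℝ) :
    |2 * (c * Complex.exp (-Complex.I * (b : ℂ) * (t : ℂ))).re| ≤ 2 * ‖c‖ := by
  rw [abs_mul, abs_two]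
  gcongr
  refine (Complex.abs_re_le_norm _).trans ?_
  rw [norm_mul, Complex.norm_exp]
  simp

theorem abs_two_mul_re_sub_le (c : ℂ) (b : ℝ) {s t : ℝ} (hst : s ≤ t) :
    |2 * (c * Complex.exp (-Complex.I * (b : ℂ) * (t : ℂ))).re -
      2 * (c * Complex.exp (-Complex.I * (b : ℂ) * (s : ℂ))).re| ≤ 2 * ‖c‖ * |b| * (t - s) := by
  rw [← mul_sub, abs_mul, abs_two, ← Complex.sub_re, ← mul_sub,
    (by ring : 2 * ‖c‖ * |b| * (t - s) = 2 * (‖c‖ * (|b| * (t - s))))]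
  refine mul_le_mul_of_nonneg_left ?_ zero_le_two
  refine (Complex.abs_re_le_norm _).trans ?_
  rw [norm_mul]
  gcongr
  have e : Complex.exp (-Complex.I * (b : ℂ) * (t : ℂ)) -
      Complex.exp (-Complex.I * (b : ℂ) * (s : ℂ)) =
      Complex.exp (-Complex.I * (b : ℂ) * (s : ℂ)) *
        (Complex.exp (Complex.I * ((-(b * (t - s)) : ℝ) : ℂ)) - 1) := by
    rw [mul_sub, ← Complex.exp_add]
    push_cast
    ring_nf
  rw [e, norm_mul, Complex.norm_exp]
  have h := Real.norm_exp_I_mul_ofReal_sub_one_le (x := -(b * (t - s)))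
  rw [norm_neg, norm_mul, Real.norm_eq_abs, Real.norm_of_nonneg (by linarith : 0 ≤ t - s)] at h
  simpa using h

/-- R is chosen before ω, because the final constant may depend on the exponents only through Ω. The
weighted bound serves the global estimate, the Lipschitz bound the local one. -/
theorem exists_oscTerm_bounds (c : ℂ) (b Ω : ℝ) : ∃ R : ℝ, 0 ≤ R ∧ ∀ ω, -1 < ω → ω ≤ Ω →
    ∀ y, 1 ≤ y →
      (∀ t, 0 < t → |oscTerm c b ω t| * expWeight y t ≤ R * y ^ max Ω 0) ∧
      ∀ s t, y / 2 ≤ s → s ≤ t → t ≤ 3 * y / 2 →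
        |oscTerm c b ω t - oscTerm c b ω s| ≤ R * y ^ max Ω 0 * (t - s) := by
  obtain ⟨D, hD0, hD⟩ := exists_inv_Gamma_le Ω
  set P := max Ω 0
  have hP : 0 ≤ P := le_max_right _ _
  set R₁ : ℝ := D * (2 * ‖c‖) * (⌈P⌉₊).factorial with hR₁
  set R₂ : ℝ := D * (2 * ‖c‖) * ((P + 1) * 2 * 2 ^ (P + 1) + |b| * 2 ^ (P + 1)) with hR₂
  have hR₁0 : 0 ≤ R₁ := by positivity
  have hR₂0 : 0 ≤ R₂ := by positivity
  refine ⟨R₁ + R₂, by positivity, fun ω h1 h2 y hy => ⟨fun t ht => ?_, fun s t hs hst ht => ?_⟩⟩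
  · have hG := Real.Gamma_pos_of_pos (by linarith : 0 < ω + 1)
    have hY : 0 ≤ y ^ P := by positivity
    have hw := rpow_mul_expWeight_le h1 h2 hy ht
    have hw0 := expWeight_nonneg (by linarith : 0 < y) ht.le
    rw [oscTerm, abs_mul, abs_div, abs_of_pos hG, abs_of_nonneg (Real.rpow_nonneg ht.le _),
      div_eq_mul_inv]
    calc t ^ ω * (Real.Gamma (ω + 1))⁻¹ * |2 * (c * Complex.exp (-Complex.I * b * t)).re| *
          expWeight y t = (Real.Gamma (ω + 1))⁻¹ *
          |2 * (c * Complex.exp (-Complex.I * b * t)).re| * (t ^ ω * expWeight y t) := by ring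
      _ ≤ D * (2 * ‖c‖) * ((⌈P⌉₊).factorial * y ^ P) := by
          gcongr
          · exact hD ω h1 h2
          · exact abs_two_mul_re_le c b t
      _ = R₁ * y ^ P := by rw [hR₁]; ring
      _ ≤ _ := by gcongr; linarith
  · have hG := Real.Gamma_pos_of_pos (by linarith : 0 < ω + 1)
    have hY : 0 ≤ y ^ P := by positivity
    have hδ : 0 ≤ t - s := by linarith
    have hs0 : 0 < s := by linarith
    have hlip := abs_rpow_sub_rpow_le h1 h2 hy hs hst ht
    have hwin := rpow_le_of_mem_window h1 h2 hy hs (hst.trans ht)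
    have o1 := abs_two_mul_re_le c b t
    have o2 := abs_two_mul_re_sub_le c b hst
    simp only [oscTerm]
    set p := 2 * (c * Complex.exp (-Complex.I * (b : ℂ) * (t : ℂ))).re
    set q := 2 * (c * Complex.exp (-Complex.I * (b : ℂ) * (s : ℂ))).re
    have e : t ^ ω / Real.Gamma (ω + 1) * p - s ^ ω / Real.Gamma (ω + 1) * q =
        (Real.Gamma (ω + 1))⁻¹ * ((t ^ ω - s ^ ω) * p + s ^ ω * (p - q)) := by
      field_simp
      ring
    rw [e, abs_mul, abs_of_pos (inv_pos.2 hG)]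
    calc (Real.Gamma (ω + 1))⁻¹ * |(t ^ ω - s ^ ω) * p + s ^ ω * (p - q)| ≤
          D * ((P + 1) * 2 * (2 ^ (P + 1) * y ^ P) * (t - s) * (2 * ‖c‖) +
            2 ^ (P + 1) * y ^ P * (2 * ‖c‖ * |b| * (t - s))) := by
          refine mul_le_mul (hD ω h1 h2) ((abs_add_le _ _).trans (add_le_add ?_ ?_))
            (abs_nonneg _) hD0
          · rw [abs_mul]
            exact mul_le_mul hlip o1 (abs_nonneg _) (by positivity)
          · rw [abs_mul, abs_of_nonneg (Real.rpow_nonneg hs0.le _)]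
            exact mul_le_mul hwin o2 (abs_nonneg _) (by positivity)
      _ = R₂ * y ^ P * (t - s) := by rw [hR₂]; ring
      _ ≤ _ := by gcongr; linarith

/-! ### Boundary behaviour of G controls the Fejér means -/

/-- Multiplication by e^{-t/y} - e^{-2t/y} turns the Fourier transform into a difference of values
of G on the lines Re s = 1/y and Re s = 2/y, where the Laplace integrals converge absolutely. -/
theorem integrable_weightedDiff_and_fejer_mean_le {a r : ℝ → ℝ} {G : ℂ → ℂ} {y : ℝ} (hy : 0 < y)
    (hint : ∀ s : ℂ, 0 < s.re → IntegrableOn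
      (fun t : ℝ => ((a t - r t : ℝ) : ℂ) * Complex.exp (-(s * t))) (Ioi 0))
    (hG : ∀ s : ℂ, 0 < s.re → G s =
      ∫ t in Ioi (0 : ℝ), ((a t - r t : ℝ) : ℂ) * Complex.exp (-(s * t))) :
    Integrable (weightedDiff a r y) ∧ ∀ T, 0 < T → ∀ p,
      |∫ t, weightedDiff a r y t * fejerKernel T (p - t)| ≤ etaOf G (1 / y) T := by
  have hre1 : ∀ τ : ℝ, 0 < (((1 / y : ℝ) : ℂ) + Complex.I * τ).re := by
    intro τ
    simpa using hy
  have hre2 : ∀ τ : ℝ, 0 < (2 * ((1 / y : ℝ) : ℂ) + Complex.I * τ).re := by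
    intro τ
    have : (2 * ((1 / y : ℝ) : ℂ) + Complex.I * τ).re = 2 * (1 / y) := by
      rw [Complex.add_re, ← Complex.ofReal_ofNat, ← Complex.ofReal_mul, Complex.ofReal_re]
      simp
    rw [this]
    positivity
  have hsplit : ∀ (τ t : ℝ),
      (weightedDiff a r y t : ℂ) * Complex.exp (-(Complex.I * τ * t)) =
      (Ioi (0 : ℝ)).indicator (fun t : ℝ =>
        ((a t - r t : ℝ) : ℂ) * Complex.exp (-((((1 / y : ℝ) : ℂ) + Complex.I * τ) * t)) -
        ((a t - r t : ℝ) : ℂ) *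
          Complex.exp (-((2 * ((1 / y : ℝ) : ℂ) + Complex.I * τ) * t))) t := by
    intro τ t
    by_cases ht : t ∈ Ioi (0 : ℝ)
    · rw [indicator_of_mem ht, weightedDiff_of_pos a r y ht, expWeight]
      have e1 : Complex.exp (-((((1 / y : ℝ) : ℂ) + Complex.I * τ) * t)) =
          Complex.exp (-(t / y)) * Complex.exp (-(Complex.I * τ * t)) := by
        rw [← Complex.exp_add]
        push_cast
        ring_nf
      have e2 : Complex.exp (-((2 * ((1 / y : ℝ) : ℂ) + Complex.I * τ) * t)) =
          Complex.exp (-(2 * t / y)) * Complex.exp (-(Complex.I * τ * t)) := by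
        rw [← Complex.exp_add]
        push_cast
        ring_nf
      rw [e1, e2]
      push_cast
      ring
    · rw [indicator_of_notMem ht, weightedDiff, indicator_of_notMem ht]
      simp
  have hH : Integrable (weightedDiff a r y) := by
    have h0 : Integrable fun t : ℝ => (weightedDiff a r y t : ℂ) := by
      have h1 := ((hint _ (hre1 0)).sub (hint _ (hre2 0))).integrable_indicator measurableSet_Ioi
      refine h1.congr ?_
      filter_upwards with t
      have := hsplit 0 t
      rw [Complex.ofReal_zero, mul_zero, zero_mul, neg_zero, Complex.exp_zero, mul_one] at this
      rw [this]
      simp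
      rfl
    simpa using h0.re
  refine ⟨hH, fun T hT p => (abs_integral_mul_fejerKernel_le hH hT p).trans ?_⟩
  have hcont := (continuous_integral_mul_cexp hH).norm
  have hval : ∀ τ : ℝ, ‖∫ t, (weightedDiff a r y t : ℂ) * Complex.exp (-(Complex.I * τ * t))‖ =
      ‖G (2 * ((1 / y : ℝ) : ℂ) + Complex.I * (τ : ℂ)) -
        G (((1 / y : ℝ) : ℂ) + Complex.I * (τ : ℂ))‖ := by
    intro τ
    simp only [hsplit]
    rw [integral_indicator measurableSet_Ioi, integral_sub (hint _ (hre1 τ)) (hint _ (hre2 τ)),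
      ← hG _ (hre1 τ), ← hG _ (hre2 τ), norm_sub_rev]
  rw [etaOf]
  simp only [← hval]
  -- The Fejér bound needs only [0, T]; η integrates over the larger interval [-T, T].
  exact intervalIntegral.integral_mono_interval (by linarith) hT.le le_rfl
    (by filter_upwards with τ using norm_nonneg _) (hcont.intervalIntegrable _ _)

/-! ### Moderate decrease in the logarithmic variable -/

theorem IsModeratelyDecreasingWith.nonneg {F φ : ℝ → ℝ} {a B₁ B₂ : ℝ}
    (h : IsModeratelyDecreasingWith F a B₁ B₂ φ) {x : ℝ} (hx : a ≤ x) : 0 ≤ φ x := by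
  refine le_of_tendsto h.tendsto_zero ?_
  filter_upwards [eventually_ge_atTop x] with z hz
  exact h.antitoneOn hx (hx.trans hz) hz

theorem IsModeratelyDecreasingWith.le_one {F φ : ℝ → ℝ} {B₁ B₂ : ℝ}
    (h : IsModeratelyDecreasingWith F 0 B₁ B₂ φ) {x : ℝ} (hx : 0 ≤ x) : φ x ≤ 1 := by
  rw [← h.eq_one 0 (by simp)]
  exact h.antitoneOn self_mem_Ici hx hx

section Rescaled

variable {A φ : ℝ → ℝ} {B₁ B₂ : ℝ}

theorem IsModeratelyDecreasingWith.neg_mul_le (h : IsModeratelyDecreasingWith A 0 B₁ B₂ φ)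
    (hA0 : A 0 = 0) {x : ℝ} (hx : 1 ≤ x) : -((B₁ + B₂) * x) ≤ A x := by
  have h1 := h.lower_bound 0 x le_rfl (by linarith)
  rw [zero_add, hA0, h.eq_one 0 (by simp), max_eq_left zero_le_one] at h1
  nlinarith [h.B₂_pos]

/-- Apply moderate decrease between e^s and e^t and divide by e^t; s ≥ 0 turns max(1, e^s) into e^s.
-/
theorem IsModeratelyDecreasingWith.exp_mul_ge (h : IsModeratelyDecreasingWith A 0 B₁ B₂ φ)
    {s t : ℝ} (hs : 0 ≤ s) (hst : s ≤ t) :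
    Real.exp (-(t - s)) * (A (Real.exp s) * Real.exp (-s) - B₂ * φ (Real.exp s)) -
      B₁ * (1 - Real.exp (-(t - s))) ≤ A (Real.exp t) * Real.exp (-t) := by
  have h1 := h.lower_bound (Real.exp s) (Real.exp t - Real.exp s) (Real.exp_pos s).le
    (sub_nonneg.2 (Real.exp_le_exp.2 hst))
  rw [add_sub_cancel, max_eq_right (Real.one_le_exp hs)] at h1
  have h2 := mul_le_mul_of_nonneg_right h1 (Real.exp_pos (-t)).le
  have e1 : Real.exp (-(t - s)) = Real.exp s * Real.exp (-t) := by rw [← Real.exp_add]; ring_nf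
  have e2 : Real.exp s * Real.exp (-s) = 1 := by rw [← Real.exp_add]; simp
  have e3 : Real.exp t * Real.exp (-t) = 1 := by rw [← Real.exp_add]; simp
  rw [e1]
  calc _ = (Real.exp s * Real.exp (-s)) * (A (Real.exp s) * Real.exp (-t)) -
        B₂ * Real.exp s * φ (Real.exp s) * Real.exp (-t) -
        B₁ * (1 - Real.exp s * Real.exp (-t)) := by
        ring
    _ = (-B₁ * (Real.exp t - Real.exp s) - B₂ * Real.exp s * φ (Real.exp s)) * Real.exp (-t) +
        A (Real.exp s) * Real.exp (-t) := by
        rw [e2]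
        linear_combination B₁ * e3
    _ ≤ _ := by linarith

end Rescaled

/-! ### The full main term, and G as a Laplace transform -/

/-- The oscillating main term, as a function of `t = log x`. -/
noncomputable def oscSum {n : ℕ} {m : Fin (n + 1) → ℕ} (c : (k : Fin (n + 1)) → Fin (m k) → ℂ)
    (b : Fin (n + 1) → ℝ) (ω : (k : Fin (n + 1)) → Fin (m k) → ℝ) (t : ℝ) : ℝ :=
  ∑ k, ∑ l, oscTerm (c k l) (b k) (ω k l) t

theorem exists_oscSum_bounds {n : ℕ} {m : Fin (n + 1) → ℕ}
    (c : (k : Fin (n + 1)) → Fin (m k) → ℂ) (b : Fin (n + 1) → ℝ) (Ω : ℝ) :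
    ∃ R : ℝ, 0 ≤ R ∧ ∀ ω : (k : Fin (n + 1)) → Fin (m k) → ℝ, (∀ k l, -1 < ω k l) →
      (∀ k l, ω k l ≤ Ω) → ∀ y, 1 ≤ y →
      (∀ t, 0 < t → |oscSum c b ω t| * expWeight y t ≤ R * y ^ max Ω 0) ∧
      ∀ s t, y / 2 ≤ s → s ≤ t → t ≤ 3 * y / 2 →
        |oscSum c b ω t - oscSum c b ω s| ≤ R * y ^ max Ω 0 * (t - s) := by
  choose R hR0 hR using fun k l => exists_oscTerm_bounds (c k l) (b k) Ω
  refine ⟨∑ k, ∑ l, R k l, Finset.sum_nonneg fun k _ => Finset.sum_nonneg fun l _ => hR0 k l,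
    fun ω h1 h2 y hy => ⟨fun t ht => ?_, fun s t hs hst ht => ?_⟩⟩
  · have hw := expWeight_nonneg (by linarith : 0 < y) ht.le
    calc |oscSum c b ω t| * expWeight y t ≤
          (∑ k, ∑ l, |oscTerm (c k l) (b k) (ω k l) t|) * expWeight y t := by
          gcongr
          exact (Finset.abs_sum_le_sum_abs _ _).trans
            (Finset.sum_le_sum fun k _ => Finset.abs_sum_le_sum_abs _ _)
      _ ≤ _ := by
          simp only [Finset.sum_mul]
          exact Finset.sum_le_sum fun k _ => Finset.sum_le_sum fun l _ =>
            ((hR k l (ω k l) (h1 k l) (h2 k l) y hy).1 t ht)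
  · calc |oscSum c b ω t - oscSum c b ω s| =
          |∑ k, ∑ l, (oscTerm (c k l) (b k) (ω k l) t - oscTerm (c k l) (b k) (ω k l) s)| := by
          simp only [oscSum, Finset.sum_sub_distrib]
      _ ≤ ∑ k, ∑ l, |oscTerm (c k l) (b k) (ω k l) t - oscTerm (c k l) (b k) (ω k l) s| :=
          (Finset.abs_sum_le_sum_abs _ _).trans
            (Finset.sum_le_sum fun k _ => Finset.abs_sum_le_sum_abs _ _)
      _ ≤ _ := by
          simp only [Finset.sum_mul]
          exact Finset.sum_le_sum fun k _ => Finset.sum_le_sum fun l _ =>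
            ((hR k l (ω k l) (h1 k l) (h2 k l) y hy).2 s t hs hst ht)

theorem laplace_oscSum {n : ℕ} {m : Fin (n + 1) → ℕ}
    (c : (k : Fin (n + 1)) → Fin (m k) → ℂ) (b : Fin (n + 1) → ℝ)
    (ω : (k : Fin (n + 1)) → Fin (m k) → ℝ) (hω : ∀ k l, -1 < ω k l) {s : ℂ} (hs : 0 < s.re) :
    IntegrableOn (fun t : ℝ => (oscSum c b ω t : ℂ) * Complex.exp (-(s * t))) (Ioi 0) ∧
    ∫ t in Ioi (0 : ℝ), (oscSum c b ω t : ℂ) * Complex.exp (-(s * t)) =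
      ∑ k, ∑ l, (c k l / (s + Complex.I * (b k : ℂ)) ^ ((ω k l : ℂ) + 1) +
        (starRingEnd ℂ) (c k l) / (s - Complex.I * (b k : ℂ)) ^ ((ω k l : ℂ) + 1)) := by
  have e : (fun t : ℝ => (oscSum c b ω t : ℂ) * Complex.exp (-(s * t))) =
      fun t : ℝ => ∑ k, ∑ l, (oscTerm (c k l) (b k) (ω k l) t : ℂ) * Complex.exp (-(s * t)) := by
    ext t
    simp only [oscSum, Complex.ofReal_sum, Finset.sum_mul]
  have hi := fun k l => laplace_oscTerm (c k l) (b k) (hω k l) hs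
  rw [e]
  refine ⟨integrable_finsetSum _ fun k _ => integrable_finsetSum _ fun l _ => (hi k l).1, ?_⟩
  rw [integral_finsetSum _ fun k _ => integrable_finsetSum _ fun l _ => (hi k l).1]
  refine Finset.sum_congr rfl fun k _ => ?_
  rw [integral_finsetSum _ fun l _ => (hi k l).1]
  exact Finset.sum_congr rfl fun l _ => (hi k l).2

theorem boundaryG_eq_laplace {A : ℝ → ℝ} (hA : LocallyBoundedVariationOn A univ)
    (hA1 : ∀ x < 1, A x = 0) {B : ℝ} (hB : 0 ≤ B) (hlow : ∀ x, 1 ≤ x → -(B * x) ≤ A x)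
    (hconv : ∀ s : ℂ, 1 < s.re → MellinStieltjesConvergent hA s) {n : ℕ} {m : Fin (n + 1) → ℕ}
    (c : (k : Fin (n + 1)) → Fin (m k) → ℂ) (b : Fin (n + 1) → ℝ)
    (ω : (k : Fin (n + 1)) → Fin (m k) → ℝ) (hω : ∀ k l, -1 < ω k l) {s : ℂ} (hs : 0 < s.re) :
    IntegrableOn (fun t : ℝ => ((A (Real.exp t) * Real.exp (-t) - oscSum c b ω t : ℝ) : ℂ) *
      Complex.exp (-(s * t))) (Ioi 0) ∧
    boundaryG hA c b ω s = ∫ t in Ioi (0 : ℝ),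
      ((A (Real.exp t) * Real.exp (-t) - oscSum c b ω t : ℝ) : ℂ) * Complex.exp (-(s * t)) := by
  have hint : ∀ σ : ℝ, 1 < σ → IntegrableOn (fun u : ℝ => A u * u ^ (-σ - 1)) (Ioi 1) :=
    fun σ hσ => integrableOn_mul_rpow_of_mellinStieltjesConvergent hA hA1 hB hlow hσ
      (hconv σ (by simpa using hσ))
  have i1 : IntegrableOn (fun t : ℝ => ((A (Real.exp t) * Real.exp (-t) : ℝ) : ℂ) *
      Complex.exp (-(s * t))) (Ioi 0) := by
    have hmeas : Measurable fun t : ℝ => A (Real.exp t) * Real.exp (-t) :=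
      (hA.measurable_univ.comp Real.measurable_exp).mul (by fun_prop)
    refine Integrable.mono (integrableOn_exp_of_rpow hint hs)
      ((Complex.measurable_ofReal.comp hmeas).mul (by fun_prop)).aestronglyMeasurable ?_
    filter_upwards with t
    rw [norm_mul, norm_mul (A (Real.exp t) * Real.exp (-t)), Complex.norm_real, Complex.norm_exp,
      Real.norm_of_nonneg (Real.exp_pos (-(s.re * t))).le]
    simp
  obtain ⟨i2, v2⟩ := laplace_oscSum c b ω hω hs
  have e : (fun t : ℝ => ((A (Real.exp t) * Real.exp (-t) - oscSum c b ω t : ℝ) : ℂ) *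
      Complex.exp (-(s * t))) = fun t : ℝ => ((A (Real.exp t) * Real.exp (-t) : ℝ) : ℂ) *
      Complex.exp (-(s * t)) - (oscSum c b ω t : ℂ) * Complex.exp (-(s * t)) := by
    ext t
    rw [Complex.ofReal_sub, sub_mul]
  rw [e]
  refine ⟨i1.sub i2, ?_⟩
  rw [integral_sub i1 i2, v2, ← mellinStieltjes_div_eq_laplace hA hA1 hint hconv hs, boundaryG]

theorem etaOf_nonneg (G : ℂ → ℂ) (σ : ℝ) {T : ℝ} (hT : 0 < T) : 0 ≤ etaOf G σ T :=
  intervalIntegral.integral_nonneg (by linarith) fun _ _ => norm_nonneg _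

/-! ### Comparison with the error function -/

/-- Both Tauberian estimates are dominated by the error function. -/
theorem le_errorRho {φ : ℝ → ℝ} {η T x ωmin Ω D V : ℝ} (hT : 0 < T) (hη : 0 ≤ η)
    (hx : 1 ≤ Real.log x) (hD : 0 ≤ D) (hφ0 : 0 ≤ φ √x) (hφ1 : φ √x ≤ 1)
    (hsmall : T < 1 → V ≤ D * (Real.exp (1 / T) * (η + Real.log x ^ max Ω 0)))
    (hlarge : 1 ≤ T → V ≤ D * (η + Real.log x ^ max Ω 0 / T + φ √x)) :
    V ≤ D * errorRho φ η T x ωmin Ω := by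
  set Y := Real.log x ^ max Ω 0 with hY
  have hY0 : 0 ≤ Y := Real.rpow_nonneg (by linarith) _
  set E := errorBase η T x ωmin Ω with hE
  have hE1 : (Real.exp (10 / T) / T + 1) * η + Real.exp (10 / T) / T * Y ≤ E := by
    rw [hE, errorBase, ← hY]
    have : 0 ≤ 1 / Real.log x * (1 / T ^ (Ω + 1) + 1 / T ^ (ωmin + 1)) := by positivity
    linarith
  have hE0 : 0 ≤ E := le_trans (by positivity) hE1
  -- Only the exponent κ = 1 of the maximum is needed.
  have hρ : √(φ √x) + E ≤ errorRho φ η T x ωmin Ω := by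
    rw [errorRho, ← hE]
    gcongr
    rw [Real.rpow_one]
    exact le_max_right _ _
  have hsqrt : φ √x ≤ √(φ √x) := by
    refine Real.le_sqrt_of_sq_le ?_
    nlinarith
  have hexp : 1 ≤ Real.exp (10 / T) := Real.one_le_exp (by positivity)
  rcases lt_or_ge T 1 with h | h
  · refine (hsmall h).trans (mul_le_mul_of_nonneg_left ?_ hD)
    have h1 : Real.exp (1 / T) ≤ Real.exp (10 / T) / T := by
      have h2 : Real.exp (1 / T) ≤ Real.exp (10 / T) := by gcongr; norm_num
      rw [le_div_iff₀ hT]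
      nlinarith [Real.exp_pos (1 / T)]
    have h3 := mul_le_mul_of_nonneg_right h1 (add_nonneg hη hY0)
    have h4 := Real.sqrt_nonneg (φ √x)
    nlinarith
  · refine (hlarge h).trans (mul_le_mul_of_nonneg_left ?_ hD)
    have h1 : Y / T ≤ Real.exp (10 / T) / T * Y := by
      rw [div_mul_eq_mul_div]
      gcongr
      nlinarith
    have h2 : η ≤ (Real.exp (10 / T) / T + 1) * η := by
      have : 0 ≤ Real.exp (10 / T) / T * η := by positivity
      linarith
    linarith

/-- Linearises the rescaled decrease condition through 1 - δ ≤ e^{-δ} ≤ 1, so that the loss is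
proportional to the step plus a multiple of p. -/
theorem exp_mul_sub_ge {α p B₁ B₂ δ : ℝ} (h1 : 0 ≤ B₁) (h2 : 0 ≤ B₂) (hδ : 0 ≤ δ) (hp : 0 ≤ p) :
    α - δ * (|α| + (B₁ + B₂)) - (B₁ + B₂) * p ≤
      Real.exp (-δ) * (α - B₂ * p) - B₁ * (1 - Real.exp (-δ)) := by
  have e1 : 1 - δ ≤ Real.exp (-δ) := Real.one_sub_le_exp_neg δ
  have e2 : Real.exp (-δ) ≤ 1 := Real.exp_le_one_iff.2 (by linarith)
  have k1 : (1 - Real.exp (-δ)) * α ≤ δ * |α| := by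
    calc (1 - Real.exp (-δ)) * α ≤ (1 - Real.exp (-δ)) * |α| := by
          gcongr
          exact le_abs_self α
      _ ≤ δ * |α| := by gcongr; linarith
  have k2 : B₁ * (1 - Real.exp (-δ)) ≤ B₁ * δ := by gcongr; linarith
  have k3 : Real.exp (-δ) * (B₂ * p) ≤ B₂ * p := mul_le_of_le_one_left (by positivity) e2
  have k4 : 0 ≤ δ * B₂ := by positivity
  have k5 : 0 ≤ B₁ * p := by positivity
  linarith

end WienerIkehara

/-! ### Assembly -/

theorem mainTheorem1
    (B₁ B₂ : ℝ) (n : ℕ) (m : Fin (n + 1) → ℕ) (hm : ∀ k, 1 ≤ m k)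
    (c : (k : Fin (n + 1)) → Fin (m k) → ℂ)
    (b : Fin (n + 1) → ℝ) (hb₀ : b 0 = 0) (hb : ∀ k, k ≠ 0 → 0 < b k)
    (Ω M : ℝ) :
    -- the constant `C` depends only on the data above
    ∃ C : ℝ, ∀ (ω : (k : Fin (n + 1)) → Fin (m k) → ℝ) (ωmin : ℝ),
      (∀ k l, -1 < ω k l) →
      IsGreatest (Set.range fun p : (k : Fin (n + 1)) × Fin (m k) => ω p.1 p.2) Ω →
      IsLeast (Set.range fun p : (k : Fin (n + 1)) × Fin (m k) => ω p.1 p.2) ωmin →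
      ∀ (A : ℝ → ℝ) (hA : LocallyBoundedVariationOn A Set.univ) (φ : ℝ → ℝ),
        (∀ x < 1, A x = 0) →
        (∀ s : ℂ, 1 < s.re → MellinStieltjesConvergent hA s) →
        IsModeratelyDecreasingWith A 0 B₁ B₂ φ →
        IsLUB ((fun x => max (-A x) 0) '' Set.Icc 1 (Real.exp 1)) M →
        ∀ T : ℝ, 0 < T → ∀ x : ℝ, max (Real.exp (16 / 15)) (Real.exp (32 / T)) ≤ x →
          |A x - x * ∑ k, ∑ l, Real.log x ^ ω k l / Real.Gamma (ω k l + 1) *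
              (2 * (c k l * Complex.exp (-Complex.I * (b k : ℂ) * (Real.log x : ℂ))).re)| ≤
            C * (x * errorRho φ (etaOf (boundaryG hA c b ω) (1 / Real.log x) T) T x ωmin Ω) := by
  obtain ⟨R, hR0, hR⟩ := exists_oscSum_bounds c b Ω
  set B := B₁ + B₂ with hB
  -- 1500022 = 1500000 + 22 collects the two coefficients of η in the local estimate. The absolute
  -- value keeps the constant nonnegative before positivity of B₁ and B₂ is available.
  refine ⟨1500022 * (1 + R + |B|), ?_⟩
  intro ω ωmin hω hΩ _ A hA φ hA1 hconv hmd _ T hT x hx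
  have hB₁ := hmd.B₁_pos
  have hB₂ := hmd.B₂_pos
  have hB0 : 0 ≤ B := by linarith
  have hA0 : A 0 = 0 := hA1 0 one_pos
  have hωΩ : ∀ k l, ω k l ≤ Ω := fun k l => hΩ.2 ⟨⟨k, l⟩, rfl⟩
  have hx0 : 0 < x := (Real.exp_pos _).trans_le ((le_max_left _ _).trans hx)
  set y := Real.log x with hy
  have hexpy : Real.exp y = x := Real.exp_log hx0
  have hy1 : 1 ≤ y := by
    have : 16 / 15 ≤ y := (Real.le_log_iff_exp_le hx0).2 ((le_max_left _ _).trans hx)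
    linarith
  have hTy : 32 ≤ T * y := by
    have : 32 / T ≤ y := (Real.le_log_iff_exp_le hx0).2 ((le_max_right _ _).trans hx)
    rwa [div_le_iff₀ hT, mul_comm] at this
  have hy0 : 0 < y := by linarith
  set η := etaOf (boundaryG hA c b ω) (1 / y) T with hη
  have hη0 : 0 ≤ η := etaOf_nonneg _ _ hT
  set Y := y ^ max Ω 0 with hY
  have hY1 : 1 ≤ Y := Real.one_le_rpow hy1 (le_max_right _ _)
  set a : ℝ → ℝ := fun t => A (Real.exp t) * Real.exp (-t) with ha
  set r := oscSum c b ω with hr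
  obtain ⟨hr1, hr2⟩ := hR ω hω hωΩ y hy1
  have hlowA : ∀ z, 1 ≤ z → -(B * z) ≤ A z := fun z hz => hmd.neg_mul_le hA0 hz
  have hG := fun (s : ℂ) (hs : 0 < s.re) =>
    boundaryG_eq_laplace hA hA1 hB0 hlowA hconv c b ω hω hs
  obtain ⟨hH, hHη⟩ := integrable_weightedDiff_and_fejer_mean_le (a := a) (r := r) hy0
    (fun s hs => (hG s hs).1) (fun s hs => (hG s hs).2)
  have hHη' := hHη T hT
  have hlow : ∀ t, 0 < t → -B ≤ a t := by
    intro t ht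
    have h1 := mul_le_mul_of_nonneg_right (hlowA (Real.exp t) (Real.one_le_exp ht.le))
      (Real.exp_pos (-t)).le
    have e : -(B * Real.exp t) * Real.exp (-t) = -B * (Real.exp t * Real.exp (-t)) := by ring
    rw [e, ← Real.exp_add, add_neg_cancel, Real.exp_zero, mul_one] at h1
    exact h1
  have hmono : ∀ s t, 0 < s → s ≤ t → Real.exp (-(t - s)) * a s - B ≤ a t := by
    intro s t hs hst
    refine le_trans ?_ (hmd.exp_mul_ge hs.le hst)
    have e1 : Real.exp (-(t - s)) ≤ 1 := Real.exp_le_one_iff.2 (by linarith)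
    have e0 := Real.exp_pos (-(t - s))
    have p1 := hmd.le_one (Real.exp_pos s).le
    have p0 := hmd.nonneg (Real.exp_pos s).le
    have h1 : Real.exp (-(t - s)) * (B₂ * φ (Real.exp s)) ≤ 1 * (B₂ * 1) := by gcongr
    have h2 : 0 ≤ B₁ * Real.exp (-(t - s)) := by positivity
    rw [mul_sub]
    linarith
  set ψ := φ √x with hψ
  have hψ0 : 0 ≤ ψ := hmd.nonneg (Real.sqrt_nonneg x)
  have hψ1 : ψ ≤ 1 := hmd.le_one (Real.sqrt_nonneg x)
  have hmonoψ : ∀ s t, y / 2 ≤ s → s ≤ t → a s - (t - s) * (|a s| + B) - B * ψ ≤ a t := by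
    intro s t hs hst
    have hs0 : 0 ≤ s := by linarith
    refine le_trans ?_ (hmd.exp_mul_ge hs0 hst)
    -- The window starts at y/2 and e^{y/2} = √x, which is where φ(√x) comes from.
    have hle : φ (Real.exp s) ≤ ψ := by
      refine hmd.antitoneOn (Set.mem_Ici.2 (Real.sqrt_nonneg x))
        (Set.mem_Ici.2 (Real.exp_pos s).le) ?_
      rw [← hexpy, ← Real.exp_half]
      exact Real.exp_le_exp.2 hs
    refine le_trans ?_ (exp_mul_sub_ge hB₁.le hB₂.le (sub_nonneg.2 hst)
      (hmd.nonneg (Real.exp_pos s).le))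
    have := mul_le_mul_of_nonneg_left hle hB0
    linarith
  have hKey : |a y - r y| ≤ 1500022 * (1 + R + |B|) * errorRho φ η T x ωmin Ω := by
    rw [abs_of_nonneg hB0]
    have hRY : 0 ≤ R * Y := by positivity
    have hBY : B ≤ B * Y := le_mul_of_one_le_right hB0 hY1
    have hsum : η + R * Y + B ≤ (1 + R + B) * (η + Y) := by
      have h1 : 0 ≤ (R + B) * η := by positivity
      linarith
    -- T < 1 uses the global bound alone, with 208 = 8·26; T ≥ 1 uses the local estimate.
    refine le_errorRho hT hη0 hy1 (by positivity) hψ0 hψ1 (fun _ => ?_) (fun hT1 => ?_)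
    · have h1 := abs_weightedDiff_le hT hy0 hTy hB0 hRY hlow hmono hr1 hH hHη' y
      have h2 := abs_sub_le_mul_abs_weightedDiff (a := a) (r := r) hy0
        (by linarith : y / 2 ≤ y) (by linarith)
      have h3 := mul_le_mul_of_nonneg_left hsum (Real.exp_pos (1 / T)).le
      have h4 : 0 ≤ Real.exp (1 / T) * ((1 + R + B) * (η + Y)) := by positivity
      calc |a y - r y| ≤ 208 * (Real.exp (1 / T) * ((1 + R + B) * (η + Y))) := by linarith
        _ ≤ 1500022 * (Real.exp (1 / T) * ((1 + R + B) * (η + Y))) := by linarith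
        _ = _ := by ring
    · have h1 := abs_sub_le_of_fejer_mean hT1 hy1 hTy hB0 hRY hψ0 hlow hmono hmonoψ hr1 hr2 hH hHη'
      have h2 : (η + R * Y + B) / T ≤ (1 + R + B) * (η + Y / T) := by
        calc _ ≤ (1 + R + B) * (η + Y) / T := by gcongr
          _ = (1 + R + B) * (η / T + Y / T) := by ring
          _ ≤ _ := by
            gcongr
            exact div_le_self hη0 hT1
      have h3 : 0 ≤ (R + B) * η := by positivity
      have h4 : 0 ≤ (1 + R) * ψ := by positivity
      have h5 : 0 ≤ (1 + R + B) * (Y / T) := by positivity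
      have h6 : 0 ≤ B * ψ := by positivity
      linarith
  have hfin : A x - x * r y = x * (a y - r y) := by
    have : a y = A x * x⁻¹ := by
      rw [ha]
      simp only
      rw [Real.exp_neg, hexpy]
    rw [this]
    field_simp
  change |A x - x * r y| ≤ _
  rw [hfin, abs_mul, abs_of_pos hx0]
  calc x * |a y - r y| ≤ x * (1500022 * (1 + R + |B|) * errorRho φ η T x ωmin Ω) := by gcongr
    _ = _ := by ring
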